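/- Let $\mathbb{k}$ be a field of characteristic zero. Let $\mathrm{PL}$ be the operad of pre-Lie algebras, realised on labelled rooted trees: $\mathrm{PL}(I)$ is spanned by the rooted trees with vertex set $I$, and $T\circ_i S=\sum_f T\circ_i^f S$, where $f$ runs over all maps from the set of incoming edges of the vertex $i$ of $T$ to the set of vertices of $S$, and $T\circ_i^f S$ is obtained by putting $S$ in the place of the vertex $i$ and attaching the incoming edges of $i$ to vertices of $S$ according to $f$. Let $\mathrm{PL}^{¡}$ be its Koszul dual cooperad, the linear dual of the operadic suspension of the operad $\mathrm{Perm}$ of permutative algebras; thus $\mathrm{PL}^{¡}(n)\cong s^{n-1}\mathrm{sgn}_n\otimes\mathrm{Perm}(n)$, where $\mathrm{Perm}(n)$ has as its basis the possible choices of a marked element of $\{1,\dots,n\}$. The deformation complex $\mathrm{Def}(\mathrm{id}\colon\mathrm{PL}\to\mathrm{PL})$ is the convolution algebra $$\mathrm{Hom}^{\mathbb{S}}(\mathrm{PL}^{¡},\mathrm{PL})=\prod_{n\ge 1}\mathrm{Hom}_{\mathbb{S}_n}\bigl(\mathrm{PL}^{¡}(n),\mathrm{PL}(n)\bigr),$$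 whose factor of arity $n$ is in homological degree $1-n$, with the differential $d_\alpha=[\alpha,-]$. Here $[\phi,\psi]=\phi\triangleleft\psi-(-1)^{|\phi||\psi|}\psi\triangleleft\phi$, the convolution product $\phi\triangleleft\psi$ is the composite of the infinitesimal decomposition map of $\mathrm{PL}^{¡}$ (a sum over all trees with two vertices), of $\phi\otimes\psi$ and of the composition of $\mathrm{PL}$, and $\alpha$ is the element of degree $-1$ that sends $s(a_1\triangleleft a_2)$ to $a_1\triangleleft a_2$. Then $d_\alpha$ is a well-defined differential ($d_\alpha$ preserves equivariance and $d_\alpha^2=0$), and the complex $\mathrm{Def}(\mathrm{id}\colon\mathrm{PL}\to\mathrm{PL})$ is acyclic: its homology is zero in every degree. Moreover, the only homotopy automorphisms of $\mathrm{PL}$ are the rescalings. That is, let $\mathrm{PL}_\infty=\Omega(\mathrm{PL}^{¡})$; maps of operads $\mathrm{PL}_\infty\to\mathrm{PL}$ are given by the elements $\phi$ of degree $-1$ of the convolution algebra with $\frac12[\phi,\phi]=0$. Those that are bijective as maps $\mathrm{PL}^{¡}(2)\to\mathrm{PL}(2)$ (equivalently, for which $\mathrm{PL}_\infty\to\mathrm{PL}$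 is a quasi-isomorphism) are exactly the elements $\rho_\lambda\circ\alpha$ with $\lambda\in\mathbb{k}^\times$, where $\rho_\lambda$ is the automorphism of $\mathrm{PL}$ that multiplies $\mathrm{PL}(n)$ by $\lambda^{n-1}$; and $\lambda$ is determined by $\phi$. -/

import Mathlib

open scoped TensorProduct

namespace PreLieOperad

/-! ### Labelled rooted trees and insertion -/

/-- A rooted tree with vertex set `V`, given by its root and the function that sends a vertex
to the next vertex on the way to the root (and the root to itself). -/
@[ext] structure RTree (V : Type) where
  /-- the root vertex -/
  root : V
  /-- the next vertex towards the root; the root is fixed by convention -/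
  parent : V → V
  parent_root : parent root = root
  reaches_root : ∀ v, ∃ n : ℕ, parent^[n] v = root

namespace RTree

variable {V W I J : Type}

/-- Relabelling of the vertices along a bijection. -/
def map (e : V ≃ W) (T : RTree V) : RTree W where
  root := e T.root
  parent w := e (T.parent (e.symm w))
  parent_root := by simp [T.parent_root]
  reaches_root w := by
    obtain ⟨n, hn⟩ := T.reaches_root (e.symm w)
    refine ⟨n, ?_⟩
    have h : Function.Semiconj e T.parent (fun w => e (T.parent (e.symm w))) := fun v => by simp
    have := (h.iterate_right n) (e.symm w)
    rw [hn] at this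
    simpa using this.symm

/-- The vertices whose outgoing edge ends at `i`, that is, the incoming edges of `i`. -/
abbrev Incoming (T : RTree I) (i : I) : Type := {x : I // x ≠ i ∧ T.parent x = i}

section graft

variable [DecidableEq I] [DecidableEq J]

/-- The parent function of the tree obtained by putting `S` in the place of the vertex `i` of `T`
and attaching the incoming edges of `i` to vertices of `S` according to `f`. -/
def graftParent (T : RTree I) (i : I) (S : RTree J) (f : T.Incoming i → J) :
    {x : I // x ≠ i} ⊕ J → {x : I // x ≠ i} ⊕ J
  | .inl x => if h : T.parent x = i then .inr (f ⟨x, x.2, h⟩) else .inl ⟨T.parent x, h⟩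
  | .inr j =>
      if j = S.root then
        if h : T.parent i = i then .inr S.root else .inl ⟨T.parent i, h⟩
      else .inr (S.parent j)

/-- The root of the tree obtained by putting `S` in the place of the vertex `i` of `T`. -/
def graftRoot (T : RTree I) (i : I) (S : RTree J) : {x : I // x ≠ i} ⊕ J :=
  if h : T.root = i then .inr S.root else .inl ⟨T.root, h⟩

theorem graft_reaches_inr (T : RTree I) (i : I) (S : RTree J) (f : T.Incoming i → J) (n : ℕ) :
    ∀ j : J, S.parent^[n] j = S.root → ∃ k, (graftParent T i S f)^[k] (.inr j) = .inr S.root := by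
  induction n with
  | zero => intro j h; exact ⟨0, by simpa using h⟩
  | succ n ih =>
    intro j h
    by_cases hj : j = S.root
    · exact ⟨0, by simp [hj]⟩
    · obtain ⟨k, hk⟩ := ih (S.parent j) (by simpa using h)
      exact ⟨k + 1, by simpa [graftParent, hj] using hk⟩

theorem graft_reaches (T : RTree I) (i : I) (S : RTree J) (f : T.Incoming i → J) (n : ℕ) :
    ∀ x : I, T.parent^[n] x = T.root →
      (∀ h : x ≠ i, ∃ k, (graftParent T i S f)^[k] (.inl ⟨x, h⟩) = graftRoot T i S) ∧
      (x = i → ∀ j, ∃ k, (graftParent T i S f)^[k] (.inr j) = graftRoot T i S) := by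
  induction n with
  | zero =>
    intro x h
    have h : x = T.root := by simpa using h
    subst h
    refine ⟨fun h => ⟨0, by simp [graftRoot, h]⟩, fun h j => ?_⟩
    obtain ⟨m, hm⟩ := S.reaches_root j
    obtain ⟨k, hk⟩ := graft_reaches_inr T i S f m j hm
    exact ⟨k, by simpa [graftRoot, h] using hk⟩
  | succ n ih =>
    intro x h
    obtain ⟨h1, h2⟩ := ih (T.parent x) (by simpa using h)
    refine ⟨fun hx => ?_, fun hx j => ?_⟩
    · by_cases hp : T.parent x = i
      · obtain ⟨k, hk⟩ := h2 hp (f ⟨x, hx, hp⟩)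
        exact ⟨k + 1, by simpa [graftParent, hp] using hk⟩
      · obtain ⟨k, hk⟩ := h1 hp
        exact ⟨k + 1, by simpa [graftParent, hp] using hk⟩
    · subst hx
      by_cases hp : T.parent x = x
      · exact h2 hp j
      · obtain ⟨m, hm⟩ := S.reaches_root j
        obtain ⟨k, hk⟩ := graft_reaches_inr T x S f m j hm
        obtain ⟨k', hk'⟩ := h1 hp
        refine ⟨k' + 1 + k, ?_⟩
        rw [Function.iterate_add_apply, hk, Function.iterate_add_apply]
        simpa [graftParent, hp] using hk'

/-- The tree `T ∘ᵢᶠ S`: the tree `S` is put in the place of the vertex `i` of `T`, and the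
incoming edges of `i` are attached to vertices of `S` according to `f`. -/
def graft (T : RTree I) (i : I) (S : RTree J) (f : T.Incoming i → J) :
    RTree ({x : I // x ≠ i} ⊕ J) where
  root := graftRoot T i S
  parent := graftParent T i S f
  parent_root := by
    by_cases h : T.root = i
    · have hi : T.parent i = i := by rw [← h, T.parent_root]
      simp [graftRoot, graftParent, h, hi]
    · simp [graftRoot, graftParent, h, T.parent_root]
  reaches_root v := by
    rcases v with x | j
    · obtain ⟨n, hn⟩ := T.reaches_root x
      exact (graft_reaches T i S f n x hn).1 x.2
    · obtain ⟨n, hn⟩ := T.reaches_root i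
      exact (graft_reaches T i S f n i hn).2 rfl j

end graft

/-- The tree in which every vertex other than `v` is a child of the root `v`. -/
def corolla (v : V) : RTree V where
  root := v
  parent _ := v
  parent_root := rfl
  reaches_root _ := ⟨1, rfl⟩

end RTree

noncomputable section

variable (k : Type*) [Field k]

/-! ### The operad `PL`, with components indexed by finite sets of labels -/

/-- The component of the operad `PL` on the label set `V`: the span of rooted trees on `V`. -/
abbrev PL (V : Type) : Type _ := RTree V →₀ k

/-- Relabelling in `PL`. For a permutation of `V` this is the action of the symmetric group. -/
def PL.map {V W : Type} (e : V ≃ W) : PL k V →ₗ[k] PL k W :=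
  Finsupp.lmapDomain k k (RTree.map e)

/-- The operadic insertion `T ∘ᵢ S = ∑ f, T ∘ᵢᶠ S`. -/
def PL.comp {I J : Type} [Fintype I] [DecidableEq I] [Fintype J] [DecidableEq J] (i : I) :
    PL k I →ₗ[k] PL k J →ₗ[k] PL k ({x : I // x ≠ i} ⊕ J) :=
  Finsupp.linearCombination k fun T =>
    Finsupp.linearCombination k fun S =>
      ∑ f : T.Incoming i → J, Finsupp.single (RTree.graft T i S f) (1 : k)

/-- The intrinsic automorphism of `PL` defined by `c`, in arity `n`: rescaling by `c ^ (n - 1)`. -/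
def PL.rescale (c : k) (n : ℕ) : PL k (Fin n) →ₗ[k] PL k (Fin n) :=
  c ^ (n - 1) • LinearMap.id

/-! ### The Koszul dual operad `Perm` and the Koszul dual cooperad of `PL` -/

/-- The insertion `e_a ∘ᵢ e_b` of the operad `Perm` on basis elements, that is on sets with a marked
element: if `i` is the marked element `a`, then `b` becomes marked, otherwise `a` stays marked. -/
def permComp {I J : Type} [DecidableEq I] (i : I) (a : I) (b : J) : {x : I // x ≠ i} ⊕ J :=
  if h : a = i then .inr b else .inl ⟨a, h⟩

/-- The arity `n` component of the Koszul dual cooperad of `PL`, the linear dual of the operadic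
suspension of `Perm`. It is concentrated in homological degree `n - 1`, and the basis
element `Finsupp.single v 1` is dual to the element of `Perm` with the marked element `v`. -/
abbrev PLDual (n : ℕ) : Type _ := Fin n →₀ k

/-- The symmetric group acts on `PLDual k n` by permuting marked elements, twisted by the sign. -/
def PLDual.act {n : ℕ} (σ : Equiv.Perm (Fin n)) : PLDual k n →ₗ[k] PLDual k n :=
  ((Equiv.Perm.sign σ : ℤ) : k) • Finsupp.lmapDomain k k σ

section decompositions

variable {n m N : ℕ}

/-- The two-vertex trees with leaves `Fin N`, with `m` leaves at the upper vertex and `n` leaves at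
the lower vertex (which has one more input, the edge from the upper vertex): such a tree is given
by the set of leaves at the upper vertex. -/
abbrev TwoVertex (m N : ℕ) : Type := {A : Finset (Fin N) // A.card = m}

theorem TwoVertex.card_compl (h : m + n = N) (A : TwoVertex m N) : (A.1ᶜ).card = n := by
  rw [Finset.card_compl, A.2, Fintype.card_fin]
  omega

/-- The increasing enumerations of the leaves at the upper vertex and at the lower vertex. -/
def TwoVertex.enum (h : m + n = N) (A : TwoVertex m N) : Fin m ⊕ Fin n ≃ Fin N :=
  finSumEquivOfFinset A.2 (A.card_compl h)

/-- The sign of the shuffle that lists the leaves at the upper vertex first, both groups of leaves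
being in increasing order. -/
def TwoVertex.sign (h : m + n = N) (A : TwoVertex m N) : ℤ :=
  Equiv.Perm.sign ((finCongr h).symm.trans (finSumFinEquiv.symm.trans (A.enum h)))

/-- The identification of the inputs of a two-vertex tree with its leaves. The inputs of
the lower vertex are numbered so that the edge from the upper vertex is the first one, and the
leaves come next, in increasing order. -/
def TwoVertex.label (h : m + n = N) (A : TwoVertex m N) :
    {x : Fin (n + 1) // x ≠ 0} ⊕ Fin m ≃ Fin N :=
  ((Equiv.sumComm _ _).trans
    ((Equiv.refl (Fin m)).sumCongr (finSuccAboveEquiv (0 : Fin (n + 1))).symm)).trans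
      (A.enum h)

/-- The component of the infinitesimal decomposition map of the cooperad that corresponds to a
two-vertex tree: the transpose of the composition along that tree in the suspension of `Perm`.
The suspension contributes only the sign of the shuffle, since insertion is at the first input. -/
def PLDual.decomp (h : m + n = N) (A : TwoVertex m N) :
    PLDual k N →ₗ[k] PLDual k (n + 1) ⊗[k] PLDual k m :=
  Finsupp.linearCombination k fun v =>
    (A.sign h : k) • ∑ a : Fin (n + 1), ∑ b : Fin m,
      if A.label h (permComp 0 a b) = v then
        (Finsupp.single a (1 : k) : PLDual k (n + 1)) ⊗ₜ[k] (Finsupp.single b (1 : k) : PLDual k m)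
      else 0

/-- The composition map of `PL` along a two-vertex tree. -/
def PL.compAlong (h : m + n = N) (A : TwoVertex m N) :
    PL k (Fin (n + 1)) ⊗[k] PL k (Fin m) →ₗ[k] PL k (Fin N) :=
  TensorProduct.lift ((PL.comp k (0 : Fin (n + 1))).compr₂ (PL.map k (A.label h)))

end decompositions

/-! ### The convolution Lie algebra and the deformation complex of the identity map -/

/-- Linear maps from the arity `n` component of the Koszul dual cooperad to that of `PL`.
They have homological degree `1 - n`. -/
abbrev ConvHom (n : ℕ) : Type _ := PLDual k n →ₗ[k] PL k (Fin n)

variable {k}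

/-- The convolution product `φ ◁ ψ`: decompose, apply `φ ⊗ ψ`, compose, and sum
over all two-vertex trees. The sign is the Koszul sign of the evaluation
`(φ ⊗ ψ) (x ⊗ y) = (-1) ^ (|ψ| |x|) φ x ⊗ ψ y`, where `|ψ| = 1 - m` and `|x| = n`. -/
def conv {n m N : ℕ} (h : m + n = N) (φ : ConvHom k (n + 1)) (ψ : ConvHom k m) : ConvHom k N :=
  ∑ A : TwoVertex m N,
    (-1 : k) ^ ((m + 1) * n) •
      (PL.compAlong k h A ∘ₗ TensorProduct.map φ ψ ∘ₗ PLDual.decomp k h A)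

/-- The graded Lie bracket `[φ, ψ] = φ ◁ ψ - (-1) ^ (|φ| |ψ|) ψ ◁ φ` of maps of arities `p + 1`
and `q + 1`, whose degrees are `-p` and `-q`. -/
def bracket {p q r : ℕ} (h : p + q = r) (φ : ConvHom k (p + 1)) (ψ : ConvHom k (q + 1)) :
    ConvHom k (r + 1) :=
  conv (show (q + 1) + p = r + 1 by omega) φ ψ -
    (-1 : k) ^ (p * q) • conv (show (p + 1) + q = r + 1 by omega) ψ φ

variable (k)

/-- The degree `-p` component of the convolution Lie algebra: the maps of arity `p + 1` that commute
with the actions of the symmetric group. The whole algebra is the product of these over `p`. -/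
def Def (p : ℕ) : Submodule k (ConvHom k (p + 1)) where
  carrier := {φ | ∀ σ : Equiv.Perm (Fin (p + 1)), φ ∘ₗ PLDual.act k σ = PL.map k σ ∘ₗ φ}
  add_mem' {φ ψ} hφ hψ σ := by
    have h1 := hφ σ
    have h2 := hψ σ
    rw [LinearMap.add_comp, LinearMap.comp_add, h1, h2]
  zero_mem' σ := by simp
  smul_mem' c φ hφ σ := by
    have h1 := hφ σ
    rw [LinearMap.smul_comp, LinearMap.comp_smul, h1]

/-- The Maurer--Cartan element of the identity map of `PL`. It sends the suspension of the
generator `a₁ ◁ a₂`, which is `Finsupp.single 0 1`, to `a₁ ◁ a₂`, the tree with two vertices and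
the root `a₁`; the other value is forced by equivariance. -/
def alpha : ConvHom k 2 :=
  Finsupp.linearCombination k fun v : Fin 2 =>
    (-1 : k) ^ (v : ℕ) • Finsupp.single (RTree.corolla v) (1 : k)

variable {k}

/-- The differential `d_α = [α, -]` of the deformation complex; the operad `PL` itself has zero
differential. It lowers the homological degree from `-p` to `-(p + 1)`. -/
def diff {p : ℕ} (φ : ConvHom k (p + 1)) : ConvHom k (p + 1 + 1) :=
  bracket (show 1 + p = p + 1 by omega) (alpha k) φ

/-- Maps of operads from the minimal model `PL_∞` (the cobar construction of the Koszul dual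
cooperad) to `PL` are the Maurer--Cartan elements `φ` of degree `-1`; a homotopy automorphism
of `PL` is such a map that is a quasi-isomorphism, which amounts to bijectivity on the generators
of arity two. The cobar construction uses the cooperad without its counit, so
there is nothing in degree zero to produce gauge equivalences: homotopic maps are equal. -/
structure IsHomotopyAutomorphism (φ : ConvHom k 2) : Prop where
  equivariant : φ ∈ Def k 1
  maurerCartan : (2 : k)⁻¹ • bracket (show 1 + 1 = 2 by rfl) φ φ = 0
  bijective : Function.Bijective φ

end

end PreLieOperad

/-! A cochain `φ` is recorded by its coefficients `coeff φ e v f`, where `e` enumerates a finite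
vertex set, `v` is the marked vertex and `f` is the parent function of a tree; self-maps that are
not trees get coefficient zero. Equivariance says that permuting `e` multiplies the coefficient by a
sign.

In these terms the differential removes one vertex (`coeff_diff`). The product `α ◁ φ` removes a
leaf or the root; the product `φ ◁ α` contracts an edge, that is, removes a vertex other than the
root. In the bracket the removals of leaves cancel. What remains is the removal of an unmarked inner
vertex other than the root, and, if the root is marked, the removal of the root followed by a sum
over all new positions of the mark. A root with several children contributes nothing, since its
removal leaves several components. The signs are those of a simplicial boundary, so `d² = 0` because
removing two vertices is antisymmetric in their order (`diff_diff`).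

The removals that contribute leave the set of leaves unchanged. This allows a homotopy `h`: insert a
new vertex into the edge going out of a leaf, and average over the leaves. Let `φ` be a cocycle and
evaluate `dφ = 0` at the enlarged tree. Removing the new vertex gives back the coefficient of `φ` at
the original tree, and the other terms form the coefficient of `d h φ`, with one exception: when a
marked root is removed, the mark may move to the new vertex, a term that `h` does not see. So `d h φ
= φ` at trees whose root is not marked. Then `φ' = φ - d h φ` is a cocycle supported on trees with
marked root. For it the exceptional term vanishes in arity at least three, because the new vertex
does not become the root, and so `d h φ' = φ'`. Hence `φ = d (h φ + h φ')` (`coeff_diff_homotopy`,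
`exists_diff_eq`). In arities one and two everything follows from `diff_unitHom`: the differential
of the unit is `α`.

For homotopy automorphisms, an equivariant map of arity two has two parameters: `a` when the root is
marked, `b` when the other vertex is. One coefficient of `φ ◁ φ` is `b²` (`conv_self_apply`), so the
Maurer–Cartan equation forces `b = 0` and `φ = a α`. -/

namespace PreLieOperad

/-! ### Parent functions -/

section Trees

variable {V W : Type}

theorem RTree.parent_eq_self_iff (T : RTree V) {x : V} : T.parent x = x ↔ x = T.root := by
  refine ⟨fun h => ?_, fun h => h ▸ T.parent_root⟩
  obtain ⟨n, hn⟩ := T.reaches_root x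
  rwa [Function.iterate_fixed h] at hn

theorem RTree.ext_parent {T S : RTree V} (h : T.parent = S.parent) : T = S := by
  refine RTree.ext ?_ h
  rw [← S.parent_eq_self_iff, ← h, T.parent_root]

/-- A self-map with no cycles except fixed points, that is, the parent function of a forest whose
roots are fixed by convention. -/
def IsForest (f : V → V) : Prop := ∃ ρ : V → ℕ, ∀ x, f x ≠ x → ρ (f x) < ρ x

/-- A self-map that is the parent function of a rooted tree. -/
def IsTree (f : V → V) : Prop := ∃ T : RTree V, T.parent = f

theorem RTree.isTree (T : RTree V) : IsTree T.parent := ⟨T, rfl⟩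

theorem IsForest.exists_fixed {f : V → V} (hf : IsForest f) (x : V) :
    ∃ n : ℕ, f (f^[n] x) = f^[n] x := by
  obtain ⟨ρ, hρ⟩ := hf
  induction h : ρ x using Nat.strong_induction_on generalizing x with
  | _ m ih =>
    by_cases hx : f x = x
    · exact ⟨0, hx⟩
    · obtain ⟨n, hn⟩ := ih _ (h ▸ hρ x hx) (f x) rfl
      exact ⟨n + 1, hn⟩

theorem IsTree.isForest {f : V → V} (hf : IsTree f) : IsForest f := by
  classical
  obtain ⟨T, rfl⟩ := hf
  refine ⟨fun x => Nat.find (T.reaches_root x), fun x hx => ?_⟩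
  have h := Nat.find_spec (T.reaches_root x)
  obtain ⟨m, hm⟩ : ∃ m, Nat.find (T.reaches_root x) = m + 1 := by
    refine Nat.exists_eq_succ_of_ne_zero fun h0 => hx ?_
    rw [h0] at h
    exact T.parent_eq_self_iff.2 h
  beta_reduce
  rw [hm] at h ⊢
  exact Nat.lt_succ_of_le (Nat.find_min' _ h)

theorem IsTree.existsUnique {f : V → V} (hf : IsTree f) : ∃! r, f r = r := by
  obtain ⟨T, rfl⟩ := hf
  exact ⟨T.root, T.parent_root, fun y hy => T.parent_eq_self_iff.1 hy⟩

theorem IsTree.unique {f : V → V} (hf : IsTree f) {x y : V} (hx : f x = x) (hy : f y = y) :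
    x = y := hf.existsUnique.unique hx hy

theorem IsForest.isTree {f : V → V} (hf : IsForest f) (h : ∃! r, f r = r) : IsTree f := by
  obtain ⟨r, hr, hu⟩ := h
  refine ⟨⟨r, f, hr, fun x => ?_⟩, rfl⟩
  obtain ⟨n, hn⟩ := hf.exists_fixed x
  exact ⟨n, hu _ hn⟩

theorem IsForest.not_two_cycle {f : V → V} (hf : IsForest f) {x y : V} (h1 : f x = y)
    (h2 : f y = x) : x = y := by
  obtain ⟨ρ, hρ⟩ := hf
  by_contra hne
  have a := hρ x (by rw [h1]; exact Ne.symm hne)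
  have b := hρ y (by rw [h2]; exact hne)
  rw [h1] at a
  rw [h2] at b
  omega

theorem IsTree.conj {f : V → V} (hf : IsTree f) (e : V ≃ W) : IsTree (e.conj f) := by
  obtain ⟨T, rfl⟩ := hf
  exact ⟨T.map e, rfl⟩

theorem isTree_conj_iff {f : V → V} (e : V ≃ W) : IsTree (e.conj f) ↔ IsTree f := by
  refine ⟨fun h => ?_, fun h => h.conj e⟩
  have h2 := h.conj e.symm
  have h3 : e.symm.conj (e.conj f) = f := by ext x; simp
  rwa [h3] at h2

instance [Finite V] : Finite (RTree V) :=
  Finite.of_injective (fun T : RTree V => T.parent) fun _ _ h => RTree.ext_parent h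

/-- A vertex without incoming edges. -/
def IsLeaf (f : V → V) (x : V) : Prop := ∀ y, f y = x → y = x

/-- The root of a tree with at least two vertices is not a leaf. -/
theorem IsTree.not_isLeaf_root {f : V → V} (hf : IsTree f) {r y : V} (hr : f r = r) (hy : y ≠ r) :
    ¬ IsLeaf f r := by
  intro hl
  have key : ∀ n : ℕ, f^[n] y ≠ r := by
    intro n
    induction n with
    | zero => exact hy
    | succ n ih =>
      rw [Function.iterate_succ_apply']
      exact fun h => ih (hl _ h)
  obtain ⟨n, hn⟩ := hf.isForest.exists_fixed y
  exact key n (hf.unique hn hr)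

open Classical in
/-- The parent function after the removal of a vertex `x`: the incoming edges of `x` are attached
to the parent of `x`, or, if `x` is a root, their sources become roots. -/
noncomputable def erase (f : V → V) (x : V) (y : {y : V // y ≠ x}) : {y : V // y ≠ x} :=
  if h : f y ≠ x then ⟨f y, h⟩ else if h' : f x ≠ x then ⟨f x, h'⟩ else y

theorem erase_of_ne {f : V → V} {x : V} {y : {y : V // y ≠ x}} (h : f y ≠ x) :
    erase f x y = ⟨f y, h⟩ := by simp [erase, h]

theorem erase_of_eq {f : V → V} {x : V} {y : {y : V // y ≠ x}} (h : f y = x) (h' : f x ≠ x) :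
    erase f x y = ⟨f x, h'⟩ := by simp [erase, h, h']

theorem erase_of_root {f : V → V} {x : V} {y : {y : V // y ≠ x}} (h : f y = x) (h' : f x = x) :
    erase f x y = y := by simp [erase, h, h']

theorem IsForest.erase {f : V → V} (hf : IsForest f) (x : V) : IsForest (erase f x) := by
  obtain ⟨ρ, hρ⟩ := hf
  refine ⟨fun y => ρ y, fun y hy => ?_⟩
  by_cases h : f y = x
  · by_cases h' : f x = x
    · exact absurd (erase_of_root h h') hy
    · rw [erase_of_eq h h']
      have h1 := hρ x h'
      have h2 := hρ y (by rw [h]; exact fun h => y.2 h.symm)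
      rw [h] at h2
      exact h1.trans h2
  · rw [erase_of_ne h] at hy ⊢
    exact hρ y fun h => hy (Subtype.ext h)

theorem erase_fixed_iff {f : V → V} (hf : IsForest f) {x : V} (hx : f x ≠ x)
    (y : {y : V // y ≠ x}) : erase f x y = y ↔ f y = y := by
  by_cases h : f y = x
  · rw [erase_of_eq h hx, Subtype.ext_iff, h]
    exact ⟨fun h' => (y.2 (hf.not_two_cycle h h')).elim, fun h' => (y.2 h'.symm).elim⟩
  · rw [erase_of_ne h, Subtype.ext_iff]

theorem erase_root_fixed_iff {f : V → V} (hf : IsTree f) {x : V} (hx : f x = x)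
    (y : {y : V // y ≠ x}) : erase f x y = y ↔ f y = x := by
  by_cases h : f y = x
  · simp [erase_of_root h hx, h]
  · rw [erase_of_ne h, Subtype.ext_iff]
    exact ⟨fun h' => (y.2 (hf.unique h' hx)).elim, fun h' => (h h').elim⟩

theorem IsTree.erase {f : V → V} (hf : IsTree f) {x : V} (hx : f x ≠ x) : IsTree (erase f x) := by
  obtain ⟨r, hr, hu⟩ := hf.existsUnique
  refine (hf.isForest.erase x).isTree ⟨⟨r, fun h => hx (h ▸ hr)⟩, ?_, fun y hy => ?_⟩
  · exact (erase_fixed_iff hf.isForest hx _).2 hr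
  · exact Subtype.ext (hu _ ((erase_fixed_iff hf.isForest hx _).1 hy))

/-- Removal of an inner vertex does not change the leaves. -/
theorem isLeaf_erase_iff {f : V → V} {x : V} (hx : f x = x ∨ ¬ IsLeaf f x) (hf : IsForest f)
    (y : {y : V // y ≠ x}) : IsLeaf (erase f x) y ↔ IsLeaf f y := by
  constructor
  · intro h z hz
    by_cases hzx : z = x
    · subst hzx
      rcases hx with hx | hx
      · exact absurd (hz ▸ hx) y.2
      · simp only [IsLeaf, not_forall] at hx
        obtain ⟨w, hw, hwz⟩ := hx
        have h1 := h ⟨w, hwz⟩ (by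
          rw [erase_of_eq hw (by rw [hz]; exact y.2)]
          exact Subtype.ext hz)
        have h2 : w = y := congrArg Subtype.val h1
        subst h2
        exact hf.not_two_cycle hz hw
    · have := h ⟨z, hzx⟩ (by
        rw [erase_of_ne (by rw [hz]; exact y.2)]
        exact Subtype.ext hz)
      exact congrArg Subtype.val this
  · intro h z hz
    by_cases hzx : f z = x
    · by_cases hxx : f x = x
      · rwa [erase_of_root hzx hxx] at hz
      · rw [erase_of_eq hzx hxx] at hz
        exact absurd (h x (congrArg Subtype.val hz)).symm y.2
    · rw [erase_of_ne hzx] at hz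
      exact Subtype.ext (h _ (congrArg Subtype.val hz))

/-- The canonical bijection between the two iterated complements of a pair of points. -/
def eraseSwap {x y : V} (h : y ≠ x) :
    {z : {z : V // z ≠ x} // z ≠ ⟨y, h⟩} ≃ {z : {z : V // z ≠ y} // z ≠ ⟨x, h.symm⟩} where
  toFun z := ⟨⟨z.1.1, fun h' => z.2 (Subtype.ext h')⟩, fun h' => z.1.2 (congrArg Subtype.val h')⟩
  invFun z := ⟨⟨z.1.1, fun h' => z.2 (Subtype.ext h')⟩, fun h' => z.1.2 (congrArg Subtype.val h')⟩
  left_inv _ := rfl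
  right_inv _ := rfl

/-- Following parents past `x` and `y` does not depend on which of them is removed first. A finite
case check on the values of `f` at `z`, `x` and `y` is enough. -/
theorem erase_erase_val {f : V → V} {x y : V} (h : y ≠ x)
    (z : {z : {z : V // z ≠ x} // z ≠ ⟨y, h⟩}) :
    (erase (erase f x) ⟨y, h⟩ z).1.1 = (erase (erase f y) ⟨x, h.symm⟩ (eraseSwap h z)).1.1 := by
  obtain ⟨⟨z, hzx⟩, hzy⟩ := z
  have hzy' : z ≠ y := fun h' => hzy (Subtype.ext h')
  have hxy := h.symm
  simp only [erase, eraseSwap, Equiv.coe_fn_mk]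
  by_cases a1 : f z = x <;> by_cases a2 : f z = y <;> by_cases b1 : f x = x <;>
    by_cases b2 : f x = y <;> by_cases c1 : f y = x <;> by_cases c2 : f y = y <;>
    simp_all

theorem eraseSwap_conj_erase {f : V → V} {x y : V} (h : y ≠ x) :
    (eraseSwap h).conj (erase (erase f x) ⟨y, h⟩) = erase (erase f y) ⟨x, h.symm⟩ := by
  ext z
  have := erase_erase_val (f := f) h ((eraseSwap h).symm z)
  rw [Equiv.apply_symm_apply] at this
  exact this

theorem erase_conj (e : V ≃ W) (f : V → V) (x : V) (h : ∀ y, y ≠ x ↔ e y ≠ e x) :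
    (e.subtypeEquiv h).conj (erase f x) = erase (e.conj f) (e x) := by
  ext ⟨y, hy⟩
  obtain ⟨y, rfl⟩ := e.surjective y
  simp only [Equiv.conj_apply, Equiv.subtypeEquiv_symm, Equiv.subtypeEquiv_apply, erase,
    Equiv.symm_apply_apply]
  by_cases a : f y = x <;> by_cases b : f x = x <;> simp [a, b]

end Trees

/-! ### Enumerations of vertices and their signs -/

section Enumerations

variable {V W : Type} {n : ℕ}

/-- The enumeration of the complement of `x` that is induced by an enumeration of the whole set. -/
def eraseEnum (e : V ≃ Fin (n + 1)) (x : V) : {y : V // y ≠ x} ≃ Fin n :=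
  (e.subtypeEquiv (q := fun i => i ≠ e x) fun _ => e.injective.ne_iff.symm).trans
    (finSuccAboveEquiv (e x)).symm

theorem succAbove_eraseEnum (e : V ≃ Fin (n + 1)) (x : V) (y : {y : V // y ≠ x}) :
    (e x).succAbove (eraseEnum e x y) = e y := by
  have h := (finSuccAboveEquiv (e x)).apply_symm_apply
    (e.subtypeEquiv (q := fun i => i ≠ e x) (fun _ => e.injective.ne_iff.symm) y)
  exact congrArg Subtype.val h

/-- The enumeration of `Option V` that starts with `none`. -/
def consEnum (e : V ≃ Fin n) : Option V ≃ Fin (n + 1) :=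
  (Equiv.optionCongr e).trans (finSuccEquiv n).symm

@[simp] theorem consEnum_none (e : V ≃ Fin n) : consEnum e none = 0 := by simp [consEnum]

@[simp] theorem consEnum_some (e : V ≃ Fin n) (y : V) : consEnum e (some y) = (e y).succ := by
  simp [consEnum]

open Classical in
/-- The enumeration that starts with `x` and goes on with an enumeration of the complement. -/
noncomputable def firstEnum (x : V) (η : {y : V // y ≠ x} ≃ Fin n) : V ≃ Fin (n + 1) :=
  (Equiv.optionSubtypeNe x).symm.trans (consEnum η)

@[simp] theorem firstEnum_self (x : V) (η : {y : V // y ≠ x} ≃ Fin n) : firstEnum x η x = 0 := by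
  simp [firstEnum]

theorem firstEnum_of_ne (x : V) (η : {y : V // y ≠ x} ≃ Fin n) {y : V} (h : y ≠ x) :
    firstEnum x η y = (η ⟨y, h⟩).succ := by
  simp [firstEnum, h]

/-- Moving `x` to the front while keeping the order of the rest is a cycle of sign `(-1) ^ (e x)`.
This is the source of the signs in the differential. -/
theorem firstEnum_eraseEnum (e : V ≃ Fin (n + 1)) (x : V) :
    firstEnum x (eraseEnum e x) = e.trans (Fin.cycleRange (e x)) := by
  ext y
  by_cases h : y = x
  · subst h
    simp
  · rw [firstEnum_of_ne _ _ h, Equiv.trans_apply, ← succAbove_eraseEnum e x ⟨y, h⟩,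
      Fin.cycleRange_succAbove]

theorem consEnum_trans (e : V ≃ Fin n) (σ : Equiv.Perm (Fin n)) :
    consEnum (e.trans σ) =
      (consEnum e).trans ((finSuccEquiv n).trans ((Equiv.optionCongr σ).trans
        (finSuccEquiv n).symm)) := by
  ext y
  cases y <;> simp [consEnum]

theorem sign_consPerm (σ : Equiv.Perm (Fin n)) :
    Equiv.Perm.sign ((finSuccEquiv n).trans ((Equiv.optionCongr σ).trans
        (finSuccEquiv n).symm)) = Equiv.Perm.sign σ := by
  rw [← Equiv.optionCongr_sign σ]
  exact Equiv.Perm.sign_symm_trans_trans (Equiv.optionCongr σ) (finSuccEquiv n).symm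

theorem val_succAbove_cases (a : Fin (n + 1)) (s : Fin n) :
    ((s : ℕ) < a ∧ (a.succAbove s : ℕ) = s) ∨ ((a : ℕ) ≤ s ∧ (a.succAbove s : ℕ) = s + 1) := by
  by_cases h : (s : ℕ) < a
  · exact Or.inl ⟨h, by simp [Fin.succAbove, Fin.lt_def, h]⟩
  · exact Or.inr ⟨not_lt.1 h, by simp [Fin.succAbove, Fin.lt_def, h]⟩

theorem eraseEnum_eraseEnum (e : V ≃ Fin (n + 2)) {x y : V} (h : y ≠ x) :
    (eraseSwap h).trans (eraseEnum (eraseEnum e y) ⟨x, h.symm⟩) =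
      eraseEnum (eraseEnum e x) ⟨y, h⟩ := by
  ext z
  have a1 := succAbove_eraseEnum (eraseEnum e y) ⟨x, h.symm⟩ (eraseSwap h z)
  have a2 := succAbove_eraseEnum e y (eraseSwap h z).1
  have b1 := succAbove_eraseEnum (eraseEnum e x) ⟨y, h⟩ z
  have b2 := succAbove_eraseEnum e x z.1
  have c1 := succAbove_eraseEnum e x ⟨y, h⟩
  have c2 := succAbove_eraseEnum e y ⟨x, h.symm⟩
  have d : e (eraseSwap h z).1 = e z.1 := rfl
  rw [Equiv.trans_apply]
  rw [← a1] at a2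
  rw [← b1] at b2
  rw [d, ← b2] at a2
  revert a2 c1 c2
  generalize (eraseEnum (eraseEnum e y) ⟨x, h.symm⟩) (eraseSwap h z) = i
  generalize (eraseEnum (eraseEnum e x) ⟨y, h⟩) z = j
  generalize eraseEnum e x ⟨y, h⟩ = s
  generalize eraseEnum e y ⟨x, h.symm⟩ = t
  generalize e x = a
  generalize e y = b
  intro c1 c2 a2
  rw [Fin.ext_iff] at c1 c2 a2
  have h1 := val_succAbove_cases a s
  have h2 := val_succAbove_cases b t
  have h3 := val_succAbove_cases b (t.succAbove i)
  have h4 := val_succAbove_cases a (s.succAbove j)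
  have h5 := val_succAbove_cases t i
  have h6 := val_succAbove_cases s j
  omega

/-- Deleting the smaller position first shifts the larger one down by one, while deleting the larger
first shifts nothing; the two total exponents differ by one. -/
theorem neg_one_pow_eraseEnum {k : Type*} [CommRing k] (e : V ≃ Fin (n + 2)) {x y : V}
    (h : y ≠ x) :
    (-1 : k) ^ (e x : ℕ) * (-1) ^ (eraseEnum e x ⟨y, h⟩ : ℕ) =
      -((-1) ^ (e y : ℕ) * (-1) ^ (eraseEnum e y ⟨x, h.symm⟩ : ℕ)) := by
  have c1 := succAbove_eraseEnum e x ⟨y, h⟩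
  have c2 := succAbove_eraseEnum e y ⟨x, h.symm⟩
  revert c1 c2
  generalize eraseEnum e x ⟨y, h⟩ = s
  generalize eraseEnum e y ⟨x, h.symm⟩ = t
  generalize e x = a
  generalize e y = b
  intro c1 c2
  rw [← pow_add, ← pow_add]
  have : (a + s : ℕ) + 1 = b + t ∨ (a + s : ℕ) = b + t + 1 := by
    rw [Fin.ext_iff] at c1 c2
    have h1 := val_succAbove_cases a s
    have h2 := val_succAbove_cases b t
    omega
  rcases this with h | h
  · rw [← h, pow_succ]; ring
  · rw [h, pow_succ]; ring

end Enumerations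

/-! ### Coefficients of cochains and equivariance -/

section Coefficients

variable {V W : Type} {k : Type*} [Field k] {n : ℕ}

open Classical in
/-- The coefficient of the tree with a given parent function, zero if there is no such tree. -/
noncomputable def val (x : PL k V) (f : V → V) : k := if h : IsTree f then x h.choose else 0

theorem val_parent (x : PL k V) (T : RTree V) : val x T.parent = x T := by
  rw [val, dif_pos T.isTree]
  exact congrArg x (RTree.ext_parent T.isTree.choose_spec)

theorem val_of_not_isTree (x : PL k V) {f : V → V} (hf : ¬ IsTree f) : val x f = 0 := dif_neg hf

theorem val_add (x y : PL k V) (f : V → V) : val (x + y) f = val x f + val y f := by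
  unfold val; split_ifs <;> simp

theorem val_sub (x y : PL k V) (f : V → V) : val (x - y) f = val x f - val y f := by
  unfold val; split_ifs <;> simp

theorem val_smul (c : k) (x : PL k V) (f : V → V) : val (c • x) f = c * val x f := by
  unfold val; split_ifs <;> simp

theorem val_zero (f : V → V) : val (0 : PL k V) f = 0 := by
  unfold val; split_ifs <;> simp

theorem RTree.map_injective (e : V ≃ W) : Function.Injective (RTree.map e) := by
  intro T S h
  apply RTree.ext_parent
  have h1 : e.conj T.parent = e.conj S.parent := congrArg RTree.parent h
  exact e.conj.injective h1

theorem PL.map_apply_map (e : V ≃ W) (x : PL k V) (T : RTree V) :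
    PL.map k e x (T.map e) = x T :=
  Finsupp.mapDomain_apply (RTree.map_injective e) x T

/-- The coefficient of a tree in the value of `φ` at a marked vertex, for trees with vertices
enumerated by `e`. -/
noncomputable def coeff (φ : ConvHom k n) (e : V ≃ Fin n) (v : V) (f : V → V) : k :=
  val (φ (Finsupp.single (e v) 1)) (e.conj f)

theorem coeff_conj (φ : ConvHom k n) (g : V ≃ W) (e : W ≃ Fin n) (v : V) (f : V → V) :
    coeff φ e (g v) (g.conj f) = coeff φ (g.trans e) v f := rfl

theorem coeff_of_not_isTree (φ : ConvHom k n) (e : V ≃ Fin n) (v : V) {f : V → V}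
    (hf : ¬ IsTree f) : coeff φ e v f = 0 :=
  val_of_not_isTree _ (by rwa [isTree_conj_iff])

theorem coeff_refl (φ : ConvHom k n) (v : Fin n) (T : RTree (Fin n)) :
    coeff φ (Equiv.refl _) v T.parent = φ (Finsupp.single v 1) T :=
  val_parent _ T

theorem coeff_add (φ ψ : ConvHom k n) (e : V ≃ Fin n) (v : V) (f : V → V) :
    coeff (φ + ψ) e v f = coeff φ e v f + coeff ψ e v f := val_add _ _ _

theorem coeff_sub (φ ψ : ConvHom k n) (e : V ≃ Fin n) (v : V) (f : V → V) :
    coeff (φ - ψ) e v f = coeff φ e v f - coeff ψ e v f := val_sub _ _ _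

theorem coeff_smul (c : k) (φ : ConvHom k n) (e : V ≃ Fin n) (v : V) (f : V → V) :
    coeff (c • φ) e v f = c * coeff φ e v f := val_smul _ _ _

theorem coeff_zero (e : V ≃ Fin n) (v : V) (f : V → V) :
    coeff (0 : ConvHom k n) e v f = 0 := val_zero _

theorem convHom_ext {φ ψ : ConvHom k n}
    (h : ∀ (v : Fin n) (T : RTree (Fin n)),
      coeff φ (Equiv.refl _) v T.parent = coeff ψ (Equiv.refl _) v T.parent) : φ = ψ := by
  refine Finsupp.lhom_ext' fun v => LinearMap.ext_ring (Finsupp.ext fun T => ?_)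
  have := h v T
  rw [coeff_refl, coeff_refl] at this
  exact this

/-- A map with prescribed coefficients. -/
noncomputable def ofCoeff (c : Fin n → RTree (Fin n) → k) : ConvHom k n :=
  Finsupp.linearCombination k fun v => Finsupp.equivFunOnFinite.symm (c v)

theorem ofCoeff_single (c : Fin n → RTree (Fin n) → k) (v : Fin n) (T : RTree (Fin n)) :
    ofCoeff c (Finsupp.single v 1) T = c v T := by
  simp [ofCoeff]

theorem mem_Def_iff {p : ℕ} {φ : ConvHom k (p + 1)} :
    φ ∈ Def k p ↔ ∀ (σ : Equiv.Perm (Fin (p + 1))) (v : Fin (p + 1)) (T : RTree (Fin (p + 1))),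
      coeff φ σ v T.parent =
        ((Equiv.Perm.sign σ : ℤ) : k) * coeff φ (Equiv.refl _) v T.parent := by
  have sq : ∀ σ : Equiv.Perm (Fin (p + 1)),
      ((Equiv.Perm.sign σ : ℤ) : k) * ((Equiv.Perm.sign σ : ℤ) : k) = 1 := by
    intro σ
    rcases Int.units_eq_one_or (Equiv.Perm.sign σ) with h | h <;> simp [h]
  have key : ∀ (σ : Equiv.Perm (Fin (p + 1))) (v : Fin (p + 1)) (T : RTree (Fin (p + 1))),
      (φ ∘ₗ PLDual.act k σ) (Finsupp.single v 1) (T.map σ) =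
          ((Equiv.Perm.sign σ : ℤ) : k) * coeff φ σ v T.parent ∧
        (PL.map k σ ∘ₗ φ) (Finsupp.single v 1) (T.map σ) =
          coeff φ (Equiv.refl _) v T.parent := by
    intro σ v T
    constructor
    · simp only [LinearMap.comp_apply, PLDual.act, LinearMap.smul_apply, map_smul,
        Finsupp.lmapDomain_apply, Finsupp.mapDomain_single, Finsupp.smul_apply, smul_eq_mul]
      rw [coeff, show σ.conj T.parent = (T.map σ).parent from rfl, val_parent]
    · rw [LinearMap.comp_apply, PL.map_apply_map, coeff_refl]
  constructor
  · intro h σ v T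
    have h1 := key σ v T
    rw [show φ ∘ₗ PLDual.act k σ = PL.map k σ ∘ₗ φ from h σ, h1.2] at h1
    rw [h1.1, ← mul_assoc, sq, one_mul]
  · intro h σ
    refine Finsupp.lhom_ext' fun v => LinearMap.ext_ring (Finsupp.ext fun T => ?_)
    have hT : T = RTree.map σ (RTree.map σ.symm T) := by
      apply RTree.ext_parent
      ext x
      simp [RTree.map]
    rw [hT]
    have h1 := key σ v (RTree.map σ.symm T)
    have h2 := h σ v (RTree.map σ.symm T)
    simp only [LinearMap.comp_apply, Finsupp.lsingle_apply] at h1 ⊢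
    rw [h1.1, h1.2, h2, ← mul_assoc, sq, one_mul]

theorem coeff_trans {p : ℕ} {φ : ConvHom k (p + 1)} (hφ : φ ∈ Def k p) (e : V ≃ Fin (p + 1))
    (σ : Equiv.Perm (Fin (p + 1))) (v : V) (f : V → V) :
    coeff φ (e.trans σ) v f = ((Equiv.Perm.sign σ : ℤ) : k) * coeff φ e v f := by
  by_cases hf : IsTree f
  · obtain ⟨T, rfl⟩ := hf
    have := mem_Def_iff.1 hφ σ (e v) (T.map e)
    exact this
  · simp [coeff_of_not_isTree _ _ _ hf]

/-- The comparison of an arbitrary enumeration of the complement of `x` with the induced one. -/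
theorem sign_firstEnum_mul_coeff {p : ℕ} {φ : ConvHom k (p + 1)} (hφ : φ ∈ Def k p)
    (e : V ≃ Fin (p + 1 + 1)) (x : V) (η : {y : V // y ≠ x} ≃ Fin (p + 1)) (b : {y : V // y ≠ x})
    (f : {y : V // y ≠ x} → {y : V // y ≠ x}) :
    ((Equiv.Perm.sign (e.symm.trans (firstEnum x η)) : ℤ) : k) * coeff φ η b f =
      (-1) ^ (e x : ℕ) * coeff φ (eraseEnum e x) b f := by
  obtain ⟨τ, rfl⟩ : ∃ τ : Equiv.Perm (Fin (p + 1)), η = (eraseEnum e x).trans τ :=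
    ⟨(eraseEnum e x).symm.trans η, by ext; simp⟩
  have h1 : firstEnum x ((eraseEnum e x).trans τ) = (firstEnum x (eraseEnum e x)).trans
      ((finSuccEquiv (p + 1)).trans ((Equiv.optionCongr τ).trans (finSuccEquiv (p + 1)).symm)) := by
    rw [firstEnum, consEnum_trans]; rfl
  have h2 : e.symm.trans (firstEnum x ((eraseEnum e x).trans τ)) =
      (Fin.cycleRange (e x)).trans ((finSuccEquiv (p + 1)).trans
        ((Equiv.optionCongr τ).trans (finSuccEquiv (p + 1)).symm)) := by
    rw [h1, firstEnum_eraseEnum]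
    ext; simp
  rw [h2, Equiv.Perm.sign_trans, sign_consPerm, coeff_trans hφ, Fin.sign_cycleRange]
  -- The sign of `τ` occurs twice, from the enumeration and from equivariance, and cancels.
  rcases Int.units_eq_one_or (Equiv.Perm.sign τ) with h | h <;> simp [h]

end Coefficients

/-! ### Coefficients of an insertion in `PL` -/

section Insertion

variable {I J : Type} {k : Type*} [Field k]

/-- The restriction of a parent function to the vertices in `J`: a vertex whose parent is
outside becomes a root. -/
def restFun {i : I} (f : {x : I // x ≠ i} ⊕ J → {x : I // x ≠ i} ⊕ J) (j : J) : J :=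
  Sum.elim (fun _ => j) id (f (.inr j))

/-- The map that collapses `J` to the point `i`. -/
def collapse {i : I} : {x : I // x ≠ i} ⊕ J → I := Sum.elim Subtype.val fun _ => i

open Classical in
/-- The parent function after collapsing the vertices in `J` to one vertex, the parent of which is
the parent of `r`. -/
noncomputable def quotFun {i : I} (f : {x : I // x ≠ i} ⊕ J → {x : I // x ≠ i} ⊕ J) (r : J)
    (x : I) : I :=
  if h : x = i then collapse (f (.inr r)) else collapse (f (.inl ⟨x, h⟩))

variable [DecidableEq I] [DecidableEq J]

theorem restFun_graft (T : RTree I) (i : I) (S : RTree J) (g : T.Incoming i → J) :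
    restFun (T.graft i S g).parent = S.parent := by
  ext j
  by_cases hj : j = S.root
  · by_cases hi : T.parent i = i <;>
      simp [restFun, RTree.graft, RTree.graftParent, hj, hi, S.parent_root]
  · simp [restFun, RTree.graft, RTree.graftParent, hj]

theorem quotFun_graft (T : RTree I) (i : I) (S : RTree J) (g : T.Incoming i → J) :
    quotFun (T.graft i S g).parent S.root = T.parent := by
  ext x
  by_cases hx : x = i
  · subst hx
    by_cases hi : T.parent x = x <;>
      simp [quotFun, collapse, RTree.graft, RTree.graftParent, hi]
  · by_cases hi : T.parent x = i <;>
      simp [quotFun, collapse, RTree.graft, RTree.graftParent, hi, hx]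

theorem graft_injective (T : RTree I) (i : I) (S : RTree J) :
    Function.Injective (RTree.graft T i S) := by
  intro g g' h
  ext ⟨x, hx, hp⟩
  have := congrFun (congrArg RTree.parent h) (.inl ⟨x, hx⟩)
  simpa [RTree.graft, RTree.graftParent, hp] using this

theorem exists_graft_eq {i : I} (T' : RTree ({x : I // x ≠ i} ⊕ J)) (T : RTree I) (S : RTree J)
    (hT : T.parent = quotFun T'.parent S.root) (hS : S.parent = restFun T'.parent) :
    ∃ g, RTree.graft T i S g = T' := by
  -- The attaching map is read off from `T'`. The default `S.root` is never used: a vertex with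
  -- parent `i` in the quotient has its parent in `J`.
  refine ⟨fun x => Sum.elim (fun _ => S.root) id (T'.parent (.inl ⟨x.1, x.2.1⟩)), ?_⟩
  apply RTree.ext_parent
  ext1 z
  rcases z with ⟨x, hx⟩ | j
  · have h1 : T.parent x = collapse (T'.parent (.inl ⟨x, hx⟩)) := by
      rw [hT]; simp [quotFun, hx]
    rcases h2 : T'.parent (.inl ⟨x, hx⟩) with y | j
    · rw [h2] at h1
      have h3 : T.parent x = y := h1
      simp [RTree.graft, RTree.graftParent, h3, y.2]
    · rw [h2] at h1
      have h3 : T.parent x = i := h1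
      simp [RTree.graft, RTree.graftParent, h3, h2]
  · have h0 : S.parent j = restFun T'.parent j := by rw [hS]
    by_cases hj : j = S.root
    · subst hj
      have h1 : T.parent i = collapse (T'.parent (.inr S.root)) := by
        rw [hT]; simp [quotFun]
      rw [S.parent_root] at h0
      rcases h2 : T'.parent (.inr S.root) with y | j
      · rw [h2] at h1
        have h3 : T.parent i = y := h1
        simp [RTree.graft, RTree.graftParent, h3, y.2]
      · rw [h2] at h1
        have h3 : T.parent i = i := h1
        have h4 : S.root = j := by rw [h0, restFun, h2]; rfl
        simp [RTree.graft, RTree.graftParent, h3, ← h4]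
    · rcases h2 : T'.parent (.inr j) with y | j'
      · have h4 : S.parent j = j := by rw [h0, restFun, h2]; rfl
        exact absurd (S.parent_eq_self_iff.1 h4) hj
      · have h4 : S.parent j = j' := by rw [h0, restFun, h2]; rfl
        simp [RTree.graft, RTree.graftParent, hj, h4]

variable [Fintype I] [Fintype J]

open Classical in
theorem val_single (T : RTree I) (f : I → I) (a : k) :
    val (Finsupp.single T a) f = if T.parent = f then a else 0 := by
  by_cases hf : IsTree f
  · obtain ⟨S, rfl⟩ := hf
    rw [val_parent, Finsupp.single_apply]
    congr 1
    exact propext ⟨fun h => h ▸ rfl, fun h => RTree.ext_parent h⟩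
  · rw [val_of_not_isTree _ hf, if_neg]
    exact fun h => hf ⟨T, h⟩

/-- The coefficients of an insertion: restrict the tree to `J` and collapse `J`. -/
theorem PL.comp_apply (i : I) (x : PL k I) (y : PL k J) (T' : RTree ({x : I // x ≠ i} ⊕ J)) (r : J)
    (hr : restFun T'.parent r = r) :
    PL.comp k i x y T' = val x (quotFun T'.parent r) * val y (restFun T'.parent) := by
  classical
  induction x using Finsupp.induction_linear with
  | zero => simp [val_zero]
  | add x1 x2 h1 h2 => simp [val_add, add_mul, h1, h2]
  | single T a =>
    induction y using Finsupp.induction_linear with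
    | zero => simp [val_zero]
    | add y1 y2 h1 h2 => simp only [map_add, Finsupp.add_apply, val_add, mul_add, h1, h2]
    | single S b =>
      rw [val_single, val_single]
      simp only [PL.comp, Finsupp.linearCombination_single, LinearMap.smul_apply,
        Finsupp.smul_apply, smul_eq_mul, Finsupp.coe_finsetSum, Finset.sum_apply,
        Finsupp.single_apply]
      by_cases h : T.parent = quotFun T'.parent r ∧ S.parent = restFun T'.parent
      · have hrS : r = S.root := by rw [← S.parent_eq_self_iff, h.2, hr]
        obtain ⟨g, hg⟩ := exists_graft_eq T' T S (hrS ▸ h.1) h.2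
        rw [if_pos h.1, if_pos h.2, Finset.sum_eq_single g]
        · simp [hg]
        · intro g' _ hne
          exact if_neg fun h' => hne (graft_injective T i S (h'.trans hg.symm))
        · simp
      -- A graft determines `T` as its quotient and `S` as its restriction, so no summand equals
      -- `T'`.
      · have h0 : ∀ g, RTree.graft T i S g ≠ T' := by
          rintro g rfl
          rw [restFun_graft] at hr h
          rw [S.parent_eq_self_iff] at hr
          subst hr
          exact h ⟨(quotFun_graft T i S g).symm, rfl⟩
        rw [Finset.sum_eq_zero fun g _ => if_neg (h0 g)]
        rw [not_and_or] at h
        rcases h with h | h <;> simp [h]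

end Insertion

/-! ### Coefficients of the convolution product -/

section Convolution

variable {k : Type*} [Field k] {n m N : ℕ}

/-- The coefficients of the convolution product. -/
theorem conv_apply (h : m + n = N) (φ : ConvHom k (n + 1)) (ψ : ConvHom k m) (v : Fin N)
    (T : RTree (Fin N)) :
    conv h φ ψ (Finsupp.single v 1) T =
      (-1) ^ ((m + 1) * n) * ∑ A : TwoVertex m N, (A.sign h : k) *
        ∑ a : Fin (n + 1), ∑ b : Fin m, if A.label h (permComp 0 a b) = v then
          PL.comp k 0 (φ (Finsupp.single a 1)) (ψ (Finsupp.single b 1)) (T.map (A.label h).symm)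
        else 0 := by
  have hT : ∀ A : TwoVertex m N, T = RTree.map (A.label h) (RTree.map (A.label h).symm T) := by
    intro A
    apply RTree.ext_parent
    ext x
    simp [RTree.map]
  simp only [conv, LinearMap.sum_apply, LinearMap.smul_apply, LinearMap.comp_apply, PLDual.decomp,
    Finsupp.linearCombination_single, one_smul, map_smul, map_sum, Finsupp.coe_finsetSum,
    Finset.sum_apply, Finsupp.smul_apply, smul_eq_mul, ← Finset.mul_sum]
  congr 1
  refine Finset.sum_congr rfl fun A _ => ?_
  congr 1
  refine Finset.sum_congr rfl fun a _ => Finset.sum_congr rfl fun b _ => ?_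
  split_ifs
  · conv_lhs => rw [hT A]
    rw [TensorProduct.map_tmul, PL.compAlong, TensorProduct.lift.tmul, LinearMap.compr₂_apply,
      PL.map_apply_map]
  · simp

end Convolution

/-! ### Insertion into a tree with two vertices -/

section LeftFactor

variable {k : Type*} [Field k] {V : Type} {m : ℕ}

/-- The vertex that is not in the upper part of a two-vertex tree with a binary lower vertex. -/
def lastVertex (L : {x : Fin (1 + 1) // x ≠ 0} ⊕ Fin m ≃ V) : V := L (.inl ⟨1, by decide⟩)

theorem apply_inl_eq_lastVertex (L : {x : Fin (1 + 1) // x ≠ 0} ⊕ Fin m ≃ V)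
    (a : {x : Fin (1 + 1) // x ≠ 0}) : L (.inl a) = lastVertex L := by
  have : a = ⟨1, by decide⟩ := Subtype.ext (Fin.eq_one_of_ne_zero _ a.2)
  rw [this, lastVertex]

theorem apply_inr_ne_lastVertex (L : {x : Fin (1 + 1) // x ≠ 0} ⊕ Fin m ≃ V) (j : Fin m) :
    L (.inr j) ≠ lastVertex L := fun h => by simpa using L.injective h

/-- The enumeration of the upper part. -/
noncomputable def upperEnum (L : {x : Fin (1 + 1) // x ≠ 0} ⊕ Fin m ≃ V) :
    {y : V // y ≠ lastVertex L} ≃ Fin m :=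
  (Equiv.ofBijective (fun j : Fin m => (⟨L (.inr j), apply_inr_ne_lastVertex L j⟩ :
      {y : V // y ≠ lastVertex L})) ⟨fun i j h => by
        simpa using congrArg Subtype.val h, fun y => by
        obtain ⟨z, hz⟩ := L.surjective y.1
        rcases z with a | j
        · exact absurd (hz.symm.trans (apply_inl_eq_lastVertex L a)) y.2
        · exact ⟨j, Subtype.ext hz⟩⟩).symm

theorem upperEnum_symm (L : {x : Fin (1 + 1) // x ≠ 0} ⊕ Fin m ≃ V) (j : Fin m) :
    ((upperEnum L).symm j : V) = L (.inr j) := rfl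

theorem apply_inr_upperEnum (L : {x : Fin (1 + 1) // x ≠ 0} ⊕ Fin m ≃ V)
    (y : {y : V // y ≠ lastVertex L}) : L (.inr (upperEnum L y)) = y := by
  rw [← upperEnum_symm, Equiv.symm_apply_apply]

theorem restFun_eq_conj_erase (L : {x : Fin (1 + 1) // x ≠ 0} ⊕ Fin m ≃ V) (f : V → V)
    (h : f (lastVertex L) = lastVertex L ∨ IsLeaf f (lastVertex L)) :
    restFun (L.symm.conj f) = (upperEnum L).conj (erase f (lastVertex L)) := by
  ext1 j
  rw [Equiv.conj_apply, ← Equiv.symm_apply_eq]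
  apply Subtype.ext
  rw [upperEnum_symm, restFun]
  simp only [Equiv.conj_apply, Equiv.symm_symm]
  by_cases hj : f (L (.inr j)) = lastVertex L
  · rcases h with h | h
    · rw [erase_of_root hj h, upperEnum_symm, hj, lastVertex]
      simp
    · exact absurd (h _ hj) (apply_inr_ne_lastVertex L j)
  · rw [erase_of_ne hj]
    obtain ⟨z, hz⟩ := L.surjective (f (L (.inr j)))
    rcases z with a | j'
    · exact absurd (hz.symm.trans (apply_inl_eq_lastVertex L a)) hj
    · change L (.inr (Sum.elim (fun _ => j) id (L.symm (f (L (.inr j)))))) = f (L (.inr j))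
      rw [← hz]
      simp

theorem quotFun_eq_corolla (L : {x : Fin (1 + 1) // x ≠ 0} ⊕ Fin m ≃ V) {f : V → V}
    (hf : IsTree f) (h : f (lastVertex L) = lastVertex L ∨ IsLeaf f (lastVertex L)) (r : Fin m)
    (hr : restFun (L.symm.conj f) r = r) [Decidable (f (lastVertex L) = lastVertex L)] :
    quotFun (L.symm.conj f) r =
      (RTree.corolla (if f (lastVertex L) = lastVertex L then (1 : Fin (1 + 1)) else 0)).parent := by
  classical
  have collapse_symm : ∀ y, collapse (L.symm y) = if y = lastVertex L then (1 : Fin (1 + 1))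
      else 0 := by
    intro y
    obtain ⟨z, rfl⟩ := L.surjective y
    rcases z with a | j
    · rw [if_pos (apply_inl_eq_lastVertex L a), Equiv.symm_apply_apply]
      exact Fin.eq_one_of_ne_zero _ a.2
    · rw [if_neg (apply_inr_ne_lastVertex L j), Equiv.symm_apply_apply]
      rfl
  -- The root of the upper part hangs from the last vertex exactly when the last vertex is the root
  -- of the whole tree.
  have hr' : f (L (.inr r)) = lastVertex L ↔ f (lastVertex L) = lastVertex L := by
    constructor
    · intro h1
      rcases h with h | h
      · exact h
      · exact absurd (h _ h1) (apply_inr_ne_lastVertex L r)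
    · intro h1
      by_contra h2
      obtain ⟨z, hz⟩ := L.surjective (f (L (.inr r)))
      rcases z with a | j
      · exact h2 (hz.symm.trans (apply_inl_eq_lastVertex L a))
      · simp only [restFun, Equiv.conj_apply, Equiv.symm_symm, ← hz, Equiv.symm_apply_apply,
          Sum.elim_inr, id_eq] at hr
        subst hr
        exact apply_inr_ne_lastVertex L j (hf.unique hz.symm h1)
  ext1 x
  have hx : quotFun (L.symm.conj f) r x =
      if f (lastVertex L) = lastVertex L then (1 : Fin (1 + 1)) else 0 := by
    unfold quotFun
    split_ifs with h1 h2 h2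
    · simp only [Equiv.conj_apply, Equiv.symm_symm, collapse_symm, if_pos (hr'.2 h2)]
    · simp only [Equiv.conj_apply, Equiv.symm_symm, collapse_symm, if_neg (mt hr'.1 h2)]
    · simp only [Equiv.conj_apply, Equiv.symm_symm, collapse_symm, apply_inl_eq_lastVertex,
        if_pos h2]
    · simp only [Equiv.conj_apply, Equiv.symm_symm, collapse_symm, apply_inl_eq_lastVertex,
        if_neg h2]
  rw [hx]
  rfl

theorem isForest_restFun {I J : Type} {i : I} {f : {x : I // x ≠ i} ⊕ J → {x : I // x ≠ i} ⊕ J}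
    (hf : IsForest f) : IsForest (restFun f) := by
  obtain ⟨ρ, hρ⟩ := hf
  refine ⟨fun j => ρ (.inr j), fun j hj => ?_⟩
  rcases h : f (.inr j) with y | j'
  · exact absurd (by rw [restFun, h]; rfl) hj
  · have h1 : restFun f j = j' := by rw [restFun, h]; rfl
    rw [h1] at hj ⊢
    beta_reduce
    rw [← h]
    exact hρ _ (by rw [h]; simpa using hj)

-- If the last vertex has a child and is not the root, then cutting it out leaves two roots in the
-- upper part, this child and the old root, so the tree does not arise by insertion. If it is a root
-- with several children, the vanishing is built into `val`.
open Classical in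
theorem comp_apply_left [DecidableEq V] (L : {x : Fin (1 + 1) // x ≠ 0} ⊕ Fin m ≃ V) (T : RTree V)
    (hm : 0 < m) (x : PL k (Fin (1 + 1))) (y : PL k (Fin m)) :
    PL.comp k 0 x y (T.map L.symm) =
      x (RTree.corolla (if T.parent (lastVertex L) = lastVertex L then 1 else 0)) *
        if T.parent (lastVertex L) = lastVertex L ∨ IsLeaf T.parent (lastVertex L) then
          val y ((upperEnum L).conj (erase T.parent (lastVertex L))) else 0 := by
  have hfor : IsForest (restFun (T.map L.symm).parent) :=
    isForest_restFun (T.map L.symm).isTree.isForest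
  obtain ⟨n, hn⟩ := hfor.exists_fixed ⟨0, hm⟩
  rw [PL.comp_apply 0 x y (T.map L.symm) _ hn]
  change val x (quotFun (L.symm.conj T.parent) _) * val y (restFun (L.symm.conj T.parent)) = _
  by_cases h1 : T.parent (lastVertex L) = lastVertex L ∨ IsLeaf T.parent (lastVertex L)
  · rw [if_pos h1, quotFun_eq_corolla L T.isTree h1 _ hn, val_parent,
      restFun_eq_conj_erase L _ h1]
  · rw [if_neg h1, val_of_not_isTree y, mul_zero, mul_zero]
    intro ht
    simp only [not_or, IsLeaf, not_forall] at h1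
    obtain ⟨h1, z, hz, hzx⟩ := h1
    have hroot : T.root ≠ lastVertex L := fun h => h1 (h ▸ T.parent_root)
    have ha : restFun (L.symm.conj T.parent) (upperEnum L ⟨z, hzx⟩) = upperEnum L ⟨z, hzx⟩ := by
      simp only [restFun, Equiv.conj_apply, Equiv.symm_symm, apply_inr_upperEnum, hz]
      simp [lastVertex]
    have hb : restFun (L.symm.conj T.parent) (upperEnum L ⟨T.root, hroot⟩) =
        upperEnum L ⟨T.root, hroot⟩ := by
      have : L.symm T.root = .inr (upperEnum L ⟨T.root, hroot⟩) := by
        rw [Equiv.symm_apply_eq, apply_inr_upperEnum]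
      simp only [restFun, Equiv.conj_apply, Equiv.symm_symm, apply_inr_upperEnum, T.parent_root]
      rw [this]
      rfl
    have hc := (upperEnum L).injective (ht.unique ha hb)
    have hd : z = T.root := congrArg Subtype.val hc
    exact hzx (by rw [← hz, hd, T.parent_root])

open Classical in
/-- The contribution of one two-vertex tree with a binary lower vertex. -/
theorem sum_comp_left [Fintype V] [DecidableEq V] (L : {x : Fin (1 + 1) // x ≠ 0} ⊕ Fin m ≃ V) (T : RTree V)
    (hm : 0 < m) (θ : ConvHom k (1 + 1)) (φ : ConvHom k m) (v : V) :
    (∑ a : Fin (1 + 1), ∑ b : Fin m, if L (permComp 0 a b) = v then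
      PL.comp k 0 (θ (Finsupp.single a 1)) (φ (Finsupp.single b 1)) (T.map L.symm) else 0) =
    ∑ b : {y : V // y ≠ lastVertex L},
      (if lastVertex L = v then θ (Finsupp.single 1 1) else if b.1 = v then
        θ (Finsupp.single 0 1) else 0)
        (RTree.corolla (if T.parent (lastVertex L) = lastVertex L then 1 else 0)) *
      if T.parent (lastVertex L) = lastVertex L ∨ IsLeaf T.parent (lastVertex L) then
        coeff φ (upperEnum L) b (erase T.parent (lastVertex L)) else 0 := by
  rw [Finset.sum_comm, ← Equiv.sum_comp (upperEnum L)]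
  refine Fintype.sum_congr _ _ fun b => ?_
  have h0 : L (permComp 0 0 (upperEnum L b)) = b := by
    simp [permComp, apply_inr_upperEnum]
  have h1 : L (permComp 0 1 (upperEnum L b)) = lastVertex L := by
    simp [permComp, lastVertex]
  rw [Fin.sum_univ_two, h0, h1]
  simp only [comp_apply_left L T hm]
  by_cases hv : lastVertex L = v
  · rw [if_pos hv, if_pos hv, if_neg (hv ▸ b.2), zero_add]
    rfl
  · rw [if_neg hv, if_neg hv, add_zero]
    by_cases hb : b.1 = v
    · rw [if_pos hb, if_pos hb]
      rfl
    · rw [if_neg hb, if_neg hb]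
      simp

end LeftFactor

/-! ### The product with a left factor of arity two: removal of a leaf or of the root -/

section ConvLeft

variable {k : Type*} [Field k] {p : ℕ}

theorem TwoVertex.label_inr {n m N : ℕ} (h : m + n = N) (A : TwoVertex m N) (j : Fin m) :
    A.label h (.inr j) = A.enum h (.inl j) := rfl

theorem TwoVertex.label_inl {n m N : ℕ} (h : m + n = N) (A : TwoVertex m N) (j : Fin n) :
    A.label h (.inl ⟨j.succ, Fin.succ_ne_zero j⟩) = A.enum h (.inr j) := by
  have : (finSuccAboveEquiv (0 : Fin (n + 1))).symm ⟨j.succ, Fin.succ_ne_zero j⟩ = j := by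
    rw [Equiv.symm_apply_eq]
    rfl
  simp [TwoVertex.label, this]

theorem TwoVertex.compl_eq (h : (p + 1) + 1 = p + 1 + 1) (A : TwoVertex (p + 1) (p + 1 + 1)) :
    (A.1)ᶜ = {lastVertex (A.label h)} := by
  have hm : lastVertex (A.label h) ∈ (A.1)ᶜ := by
    have : lastVertex (A.label h) = A.enum h (.inr 0) := A.label_inl h 0
    rw [this, TwoVertex.enum, finSumEquivOfFinset_inr]
    exact Finset.orderEmbOfFin_mem _ _ _
  refine (Finset.eq_of_subset_of_card_le (Finset.singleton_subset_iff.2 hm) ?_).symm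
  rw [A.card_compl h]
  simp

theorem TwoVertex.lastVertex_bijective (h : (p + 1) + 1 = p + 1 + 1) :
    Function.Bijective fun A : TwoVertex (p + 1) (p + 1 + 1) => lastVertex (A.label h) := by
  constructor
  · intro A B hAB
    apply Subtype.ext
    rw [← compl_inj_iff, A.compl_eq h, B.compl_eq h]
    exact congrArg _ hAB
  · intro x
    refine ⟨⟨{x}ᶜ, by simp [Finset.card_compl]⟩, ?_⟩
    have := TwoVertex.compl_eq h ⟨{x}ᶜ, by simp [Finset.card_compl]⟩
    rw [compl_compl] at this
    exact (Finset.singleton_injective this).symm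

/-- The shuffle lists the upper leaves and then the last vertex. Moving the last vertex to the front
turns this into a rotation, of sign `(-1) ^ (p + 1)`. -/
theorem TwoVertex.sign_mul_coeff_upper (h : (p + 1) + 1 = p + 1 + 1)
    (A : TwoVertex (p + 1) (p + 1 + 1)) {φ : ConvHom k (p + 1)} (hφ : φ ∈ Def k p)
    (b : {y // y ≠ lastVertex (A.label h)}) (f) :
    (A.sign h : k) * coeff φ (upperEnum (A.label h)) b f =
      (-1) ^ (p + 1) * ((-1) ^ ((lastVertex (A.label h) : Fin (p + 1 + 1)) : ℕ) *
        coeff φ (eraseEnum (Equiv.refl _) (lastVertex (A.label h))) b f) := by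
  have h1 := sign_firstEnum_mul_coeff hφ (Equiv.refl _) (lastVertex (A.label h))
    (upperEnum (A.label h)) b f
  rw [Equiv.refl_apply] at h1
  rw [← h1, ← mul_assoc]
  congr 1
  set P := (finCongr h).symm.trans (finSumFinEquiv.symm.trans (A.enum h)) with hP
  have h2 : P.trans (firstEnum (lastVertex (A.label h)) (upperEnum (A.label h))) =
      finRotate (p + 1 + 1) := by
    ext1 i
    refine Fin.lastCases ?_ (fun j => ?_) i
    · have hl : P (Fin.last (p + 1)) = lastVertex (A.label h) := by
        have h3 : finSumFinEquiv.symm (Fin.last (p + 1)) = (Sum.inr 0 : Fin (p + 1) ⊕ Fin 1) := by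
          rw [Equiv.symm_apply_eq]; rfl
        change A.enum h (finSumFinEquiv.symm (Fin.last (p + 1))) = _
        rw [h3]
        exact (A.label_inl h 0).symm
      rw [Equiv.trans_apply, hl, firstEnum_self, finRotate_last]
    · have hl : P j.castSucc = A.label h (.inr j) := by
        have h3 : finSumFinEquiv.symm (j.castSucc) = (Sum.inl j : Fin (p + 1) ⊕ Fin 1) := by
          rw [Equiv.symm_apply_eq]; rfl
        change A.enum h (finSumFinEquiv.symm j.castSucc) = _
        rw [h3]
        rfl
      rw [Equiv.trans_apply, hl, firstEnum_of_ne _ _ (apply_inr_ne_lastVertex _ j)]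
      have h4 : upperEnum (A.label h) ⟨A.label h (.inr j), apply_inr_ne_lastVertex _ j⟩ = j := by
        rw [← Equiv.eq_symm_apply]; rfl
      rw [h4]
      ext
      rw [coe_finRotate_of_ne_last (by simp [Fin.ext_iff]; omega)]
      simp
  have h5 : Equiv.Perm.sign (firstEnum (lastVertex (A.label h)) (upperEnum (A.label h))) =
      (-1) ^ (p + 1) * Equiv.Perm.sign P := by
    have := congrArg Equiv.Perm.sign h2
    rw [Equiv.Perm.sign_trans, sign_finRotate, Nat.add_sub_cancel] at this
    rw [← this, mul_assoc, Int.units_mul_self, mul_one]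
  have h6 : (A.sign h : k) = ((Equiv.Perm.sign P : ℤ) : k) := rfl
  rw [h6, show (Equiv.refl (Fin (p + 1 + 1))).symm.trans
    (firstEnum (lastVertex (A.label h)) (upperEnum (A.label h))) =
    firstEnum (lastVertex (A.label h)) (upperEnum (A.label h)) from rfl, h5]
  push_cast
  rw [← mul_assoc, ← mul_pow]
  simp

open Classical in
/-- The convolution product with a left factor of arity two. -/
theorem conv_apply_left (h : (p + 1) + 1 = p + 1 + 1) (θ : ConvHom k (1 + 1))
    {φ : ConvHom k (p + 1)} (hφ : φ ∈ Def k p) (v : Fin (p + 1 + 1)) (T : RTree (Fin (p + 1 + 1))) :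
    conv h θ φ (Finsupp.single v 1) T =
      -∑ x : Fin (p + 1 + 1), (-1) ^ (x : ℕ) * ∑ b : {y // y ≠ x},
        (if x = v then θ (Finsupp.single 1 1) else if b.1 = v then
          θ (Finsupp.single 0 1) else 0)
          (RTree.corolla (if T.parent x = x then 1 else 0)) *
        if T.parent x = x ∨ IsLeaf T.parent x then
          coeff φ (eraseEnum (Equiv.refl _) x) b (erase T.parent x) else 0 := by
  rw [conv_apply, ← (TwoVertex.lastVertex_bijective h).sum_comp, Finset.mul_sum,
    ← Finset.sum_neg_distrib]
  refine Fintype.sum_congr _ _ fun A => ?_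
  rw [sum_comp_left (A.label h) T (Nat.succ_pos p) θ φ v, Finset.mul_sum, Finset.mul_sum,
    Finset.mul_sum, ← Finset.sum_neg_distrib]
  refine Fintype.sum_congr _ _ fun b => ?_
  generalize ((if lastVertex (A.label h) = v then θ (Finsupp.single 1 1) else if b.1 = v then
    θ (Finsupp.single 0 1) else 0) : PL k (Fin (1 + 1))) (RTree.corolla
      (if T.parent (lastVertex (A.label h)) = lastVertex (A.label h) then 1 else 0)) = c
  -- The Koszul sign of the evaluation times the sign of the rotation.
  have hs : (-1 : k) ^ ((p + 1 + 1) * 1) * (-1) ^ (p + 1) = -1 := by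
    rw [← pow_add, show (p + 1 + 1) * 1 + (p + 1) = 2 * (p + 1) + 1 by ring, pow_succ, pow_mul]
    simp
  split_ifs
  · have h1 := A.sign_mul_coeff_upper h hφ b (erase T.parent (lastVertex (A.label h)))
    rw [mul_left_comm ((A.sign h : ℤ) : k), h1, mul_left_comm c, ← mul_assoc, hs]
    ring
  · simp

end ConvLeft

/-! ### Insertion of a tree with two vertices -/

section RightFactor

variable {k : Type*} [Field k] {V : Type} {n : ℕ}

theorem apply_permComp_ne (L : {x : Fin (n + 1) // x ≠ 0} ⊕ Fin 2 ≃ V) {j j' : Fin 2} (hj : j ≠ j')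
    (a : Fin (n + 1)) : L (permComp 0 a j) ≠ L (.inr j') := by
  intro h
  have := L.injective h
  unfold permComp at this
  split_ifs at this
  exact hj (by simpa using this)

/-- The enumeration of the vertices other than the source of an edge between the two vertices of the
upper part; the target of the edge comes first. -/
noncomputable def lowerEnum (L : {x : Fin (n + 1) // x ≠ 0} ⊕ Fin 2 ≃ V) {j j' : Fin 2}
    (hj : j ≠ j') : {y : V // y ≠ L (.inr j')} ≃ Fin (n + 1) :=
  (Equiv.ofBijective (fun a : Fin (n + 1) => (⟨L (permComp 0 a j), apply_permComp_ne L hj a⟩ :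
      {y : V // y ≠ L (.inr j')})) ⟨fun a b h => by
        have h1 : permComp 0 a j = permComp 0 b j := L.injective (congrArg Subtype.val h)
        unfold permComp at h1
        split_ifs at h1 with h2 h3 h3
        · rw [h2, h3]
        · simpa using h1, fun y => by
        obtain ⟨z, hz⟩ := L.surjective y.1
        rcases z with a | i
        · exact ⟨a, Subtype.ext (by simp [permComp, a.2, hz])⟩
        · refine ⟨0, Subtype.ext ?_⟩
          have hi : i ≠ j' := fun h => y.2 (by rw [← hz, h])
          have : i = j := by omega
          simp [permComp, ← this, hz]⟩).symm

theorem lowerEnum_symm (L : {x : Fin (n + 1) // x ≠ 0} ⊕ Fin 2 ≃ V) {j j' : Fin 2} (hj : j ≠ j')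
    (a : Fin (n + 1)) : ((lowerEnum L hj).symm a : V) = L (permComp 0 a j) := rfl

theorem apply_permComp_lowerEnum (L : {x : Fin (n + 1) // x ≠ 0} ⊕ Fin 2 ≃ V) {j j' : Fin 2}
    (hj : j ≠ j') (y : {y : V // y ≠ L (.inr j')}) : L (permComp 0 (lowerEnum L hj y) j) = y := by
  rw [← lowerEnum_symm L hj, Equiv.symm_apply_apply]

theorem restFun_eq_const (L : {x : Fin (n + 1) // x ≠ 0} ⊕ Fin 2 ≃ V) {j j' : Fin 2} (hj : j ≠ j')
    {f : V → V} (hf : IsForest f) (h : f (L (.inr j')) = L (.inr j)) (i : Fin 2) :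
    restFun (L.symm.conj f) i = j := by
  by_cases hi : i = j'
  · subst hi
    simp [restFun, h]
  · have : i = j := by omega
    subst this
    simp only [restFun, Equiv.conj_apply, Equiv.symm_symm]
    obtain ⟨z, hz⟩ := L.surjective (f (L (.inr i)))
    rcases z with a | l
    · simp [← hz]
    · have hl : l ≠ j' := by
        rintro rfl
        have := L.injective (hf.not_two_cycle h hz.symm)
        exact hj (by simpa using this.symm)
      have : l = i := by omega
      simp [← hz, this]

/-- Contracting an edge amounts to removing its source: the target plays the role of the merged
vertex and takes over the children of the source. -/
theorem quotFun_eq_conj_erase (L : {x : Fin (n + 1) // x ≠ 0} ⊕ Fin 2 ≃ V) {j j' : Fin 2}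
    (hj : j ≠ j') {f : V → V} (h : f (L (.inr j')) = L (.inr j)) :
    quotFun (L.symm.conj f) j = (lowerEnum L hj).conj (erase f (L (.inr j'))) := by
  have hne : f (L (.inr j')) ≠ L (.inr j') := by
    rw [h]; exact fun h' => hj (by simpa using L.injective h')
  have key : ∀ y : V, ∀ hy : y ≠ L (.inr j'), lowerEnum L hj ⟨y, hy⟩ = collapse (L.symm y) := by
    intro y hy
    obtain ⟨z, rfl⟩ := L.surjective y
    rw [← Equiv.eq_symm_apply]
    apply Subtype.ext
    rw [lowerEnum_symm, Equiv.symm_apply_apply]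
    rcases z with a | i
    · simp [permComp, collapse, a.2]
    · have hi : i ≠ j' := fun h => hy (by rw [h])
      have : i = j := by omega
      simp [permComp, collapse, this]
  have key' : collapse (L.symm (L (.inr j'))) = lowerEnum L hj ⟨f (L (.inr j')), hne⟩ := by
    rw [key, h]
    simp [collapse]
  have key2 : ∀ y : {y : V // y ≠ L (.inr j')},
      lowerEnum L hj (erase f (L (.inr j')) y) = collapse (L.symm (f y)) := by
    intro y
    by_cases hy : f y = L (.inr j')
    · rw [erase_of_eq hy hne, hy, key']
    · rw [erase_of_ne hy, key]
  ext1 a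
  rw [Equiv.conj_apply, key2, lowerEnum_symm]
  unfold quotFun permComp
  split_ifs with h1 <;> simp

theorem alpha_single (b : Fin 2) :
    alpha k (Finsupp.single b 1) = (-1 : k) ^ (b : ℕ) • Finsupp.single (RTree.corolla b) 1 := by
  simp [alpha]

open Classical in
/-- The contribution of one two-vertex tree with a binary upper vertex, if its leaves form
an edge. -/
theorem sum_comp_right [Fintype V] [DecidableEq V] (L : {x : Fin (n + 1) // x ≠ 0} ⊕ Fin 2 ≃ V)
    (T : RTree V) {j j' : Fin 2} (hj : j ≠ j') (h : T.parent (L (.inr j')) = L (.inr j))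
    (φ : ConvHom k (n + 1)) (v : V) :
    (∑ a : Fin (n + 1), ∑ b : Fin 2, if L (permComp 0 a b) = v then
      PL.comp k 0 (φ (Finsupp.single a 1)) (alpha k (Finsupp.single b 1)) (T.map L.symm) else 0) =
    (-1) ^ (j : ℕ) * ∑ b : {y : V // y ≠ L (.inr j')},
      if b.1 = v then coeff φ (lowerEnum L hj) b (erase T.parent (L (.inr j'))) else 0 := by
  have hrest := restFun_eq_const L hj T.isTree.isForest h
  have hval : ∀ a b : Fin _, PL.comp k 0 (φ (Finsupp.single a 1)) (alpha k (Finsupp.single b 1))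
      (T.map L.symm) = if b = j then (-1) ^ (j : ℕ) * val (φ (Finsupp.single a 1))
        ((lowerEnum L hj).conj (erase T.parent (L (.inr j')))) else 0 := by
    intro a b
    rw [PL.comp_apply 0 _ _ (T.map L.symm) j (hrest j), alpha_single, val_smul, val_single]
    change val _ (quotFun (L.symm.conj T.parent) j) *
      (_ * if (RTree.corolla b).parent = restFun (L.symm.conj T.parent) then 1 else 0) = _
    rw [quotFun_eq_conj_erase L hj h]
    by_cases hb : b = j
    · subst hb
      have hc : (RTree.corolla b).parent = restFun (L.symm.conj T.parent) :=
        funext fun i => (hrest i).symm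
      rw [if_pos hc, if_pos rfl]
      ring
    · rw [if_neg, if_neg hb, mul_zero, mul_zero]
      intro h1
      have h2 := congrFun h1 0
      rw [hrest] at h2
      exact hb h2
  rw [← Equiv.sum_comp (lowerEnum L hj), Finset.mul_sum]
  refine Fintype.sum_congr _ _ fun y => ?_
  rw [Finset.sum_eq_single j]
  · rw [apply_permComp_lowerEnum, hval, if_pos rfl]
    split_ifs <;> simp [coeff]
  · intro b _ hb
    rw [hval, if_neg hb, ite_self]
  · simp

/-- With no edge between the two upper leaves, both are roots of the restriction, which is therefore
not a tree. -/
theorem sum_comp_right_eq_zero [DecidableEq V] (L : {x : Fin (n + 1) // x ≠ 0} ⊕ Fin 2 ≃ V)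
    (T : RTree V) (h : ∀ j j' : Fin 2, j ≠ j' → T.parent (L (.inr j')) ≠ L (.inr j))
    (φ : ConvHom k (n + 1)) (v : V) :
    (∑ a : Fin (n + 1), ∑ b : Fin 2, if L (permComp 0 a b) = v then
      PL.comp k 0 (φ (Finsupp.single a 1)) (alpha k (Finsupp.single b 1)) (T.map L.symm) else 0) =
    0 := by
  classical
  have hrest : ∀ j, restFun (L.symm.conj T.parent) j = j := by
    intro j
    simp only [restFun, Equiv.conj_apply, Equiv.symm_symm]
    obtain ⟨z, hz⟩ := L.surjective (T.parent (L (.inr j)))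
    rcases z with a | l
    · simp [← hz]
    · have hl : l = j := by
        by_contra hl
        exact h l j hl hz.symm
      simp [← hz, hl]
  have hne : ∀ b : Fin 2, (RTree.corolla b).parent ≠ restFun (T.map L.symm).parent := by
    intro b h1
    have h2 : b = 0 := (congrFun h1 0).trans (hrest 0)
    have h3 : b = 1 := (congrFun h1 1).trans (hrest 1)
    exact absurd (h2.symm.trans h3) (by decide)
  refine Finset.sum_eq_zero fun a _ => Finset.sum_eq_zero fun b _ => ?_
  rw [PL.comp_apply 0 _ _ (T.map L.symm) 0 (hrest 0), alpha_single, val_smul, val_single,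
    if_neg (hne b), mul_zero, mul_zero, ite_self]

end RightFactor

/-! ### The product with `α` on the right: contraction of an edge -/

section ConvRight

variable {k : Type*} [Field k] {p : ℕ}

theorem TwoVertex.label_inr_mem {n m N : ℕ} (h : m + n = N) (A : TwoVertex m N) (j : Fin m) :
    A.label h (.inr j) ∈ A.1 := by
  rw [TwoVertex.label_inr, TwoVertex.enum, finSumEquivOfFinset_inl]
  exact Finset.orderEmbOfFin_mem _ _ _

theorem TwoVertex.exists_label_inr {n m N : ℕ} (h : m + n = N) (A : TwoVertex m N) {x : Fin N}
    (hx : x ∈ A.1) : ∃ j, A.label h (.inr j) = x := by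
  obtain ⟨z, rfl⟩ := (A.enum h).surjective x
  rcases z with j | j
  · exact ⟨j, rfl⟩
  · rw [TwoVertex.enum, finSumEquivOfFinset_inr] at hx
    exact absurd hx (Finset.mem_compl.1 (Finset.orderEmbOfFin_mem _ _ _))

/-- The shuffle lists the two upper leaves in increasing order, whereas the enumeration needed here
starts with the source of the edge and then its target. They differ by the identity or a
transposition, and the sign `(-1) ^ j` from `α` makes the result `-1` in both cases. -/
theorem TwoVertex.sign_mul_coeff_lower (h : (1 + 1) + p = p + 1 + 1)
    (A : TwoVertex (1 + 1) (p + 1 + 1)) {φ : ConvHom k (p + 1)} (hφ : φ ∈ Def k p)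
    {j j' : Fin 2} (hj : j ≠ j') (b : {y // y ≠ A.label h (.inr j')}) (f) :
    (A.sign h : k) * ((-1) ^ (j : ℕ) * coeff φ (lowerEnum (A.label h) hj) b f) =
      -((-1) ^ (A.label h (.inr j') : ℕ) *
        coeff φ (eraseEnum (Equiv.refl _) (A.label h (.inr j'))) b f) := by
  have h1 := sign_firstEnum_mul_coeff hφ (Equiv.refl _) (A.label h (.inr j'))
    (lowerEnum (A.label h) hj) b f
  rw [Equiv.refl_apply] at h1
  rw [← h1, ← mul_assoc, ← neg_mul]
  congr 1
  set P := (finCongr h).symm.trans (finSumFinEquiv.symm.trans (A.enum h)) with hP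
  have hinl : ∀ i : Fin 2, P (finCongr h (Fin.castAdd p i)) = A.label h (.inr i) := by
    intro i
    simp [hP, TwoVertex.label_inr]
  have hinr : ∀ i : Fin p, P (finCongr h (Fin.natAdd 2 i)) =
      A.label h (.inl ⟨i.succ, Fin.succ_ne_zero i⟩) := by
    intro i
    rw [TwoVertex.label_inl]
    simp [hP]
  have hfirst : ∀ a : Fin (p + 1), firstEnum (A.label h (.inr j')) (lowerEnum (A.label h) hj)
      (A.label h (permComp 0 a j)) = a.succ := by
    intro a
    rw [firstEnum_of_ne _ _ (apply_permComp_ne _ hj a)]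
    congr 1
    rw [← Equiv.eq_symm_apply]
    rfl
  have hf0 : firstEnum (A.label h (.inr j')) (lowerEnum (A.label h) hj)
      (A.label h (.inr j)) = 1 := by
    have := hfirst 0
    simpa [permComp] using this
  have h2 : P.trans (firstEnum (A.label h (.inr j')) (lowerEnum (A.label h) hj)) =
      if j = 1 then 1 else Equiv.swap 0 1 := by
    ext1 i
    obtain ⟨i, rfl⟩ := (finCongr h).surjective i
    refine Fin.addCases (fun i => ?_) (fun i => ?_) i
    · rw [Equiv.trans_apply, hinl]
      by_cases hi : i = j'
      · subst hi
        rw [firstEnum_self]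
        have hc : (j = 1 ∧ i = 0) ∨ (j = 0 ∧ i = 1) :=
          (by decide : ∀ a b : Fin 2, a ≠ b → (a = 1 ∧ b = 0) ∨ (a = 0 ∧ b = 1)) j i hj
        rcases hc with ⟨rfl, rfl⟩ | ⟨rfl, rfl⟩
        · rfl
        · rw [if_neg (by decide)]
          exact (Equiv.swap_apply_right _ _).symm
      · have : i = j := by omega
        subst this
        rw [hf0]
        have hc : i = 0 ∨ i = 1 := (by decide : ∀ a : Fin 2, a = 0 ∨ a = 1) i
        rcases hc with rfl | rfl
        · rw [if_neg (by decide)]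
          exact (Equiv.swap_apply_left _ _).symm
        · rfl
    · rw [Equiv.trans_apply, hinr]
      have h3 := hfirst i.succ
      rw [permComp, dif_neg (Fin.succ_ne_zero i)] at h3
      rw [h3]
      have h4 : i.succ.succ = finCongr h (Fin.natAdd 2 i) := by
        ext
        simp
      rw [← h4]
      split_ifs
      · rfl
      · rw [Equiv.swap_apply_of_ne_of_ne (Fin.succ_ne_zero _)]
        simp [Fin.ext_iff]
  have h5 : Equiv.Perm.sign (firstEnum (A.label h (.inr j')) (lowerEnum (A.label h) hj)) =
      (if j = 1 then 1 else -1) * Equiv.Perm.sign P := by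
    have := congrArg Equiv.Perm.sign h2
    rw [Equiv.Perm.sign_trans] at this
    have h6 : (if j = 1 then 1 else -1 : ℤˣ) =
        Equiv.Perm.sign (if j = 1 then (1 : Equiv.Perm (Fin (p + 1 + 1))) else Equiv.swap 0 1) := by
      split_ifs
      · simp
      · rw [Equiv.Perm.sign_swap (by simp)]
    rw [h6, ← this, mul_assoc, Int.units_mul_self, mul_one]
  have h6 : (A.sign h : k) = ((Equiv.Perm.sign P : ℤ) : k) := rfl
  rw [h6, show (Equiv.refl (Fin (p + 1 + 1))).symm.trans
    (firstEnum (A.label h (.inr j')) (lowerEnum (A.label h) hj)) =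
    firstEnum (A.label h (.inr j')) (lowerEnum (A.label h) hj) from rfl, h5]
  have hc : j = 0 ∨ j = 1 := by omega
  rcases hc with rfl | rfl <;> simp

-- At most one vertex of the pair `A` has the other one as its parent. Writing the contribution as a
-- sum over all possible sources `w` allows the sums over `A` and `w` to be exchanged.
open Classical in
theorem TwoVertex.sign_mul_sum_right (h : (1 + 1) + p = p + 1 + 1)
    (A : TwoVertex (1 + 1) (p + 1 + 1)) {φ : ConvHom k (p + 1)} (hφ : φ ∈ Def k p)
    (v : Fin (p + 1 + 1)) (T : RTree (Fin (p + 1 + 1))) :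
    (A.sign h : k) * (∑ a : Fin (p + 1), ∑ b : Fin (1 + 1), if A.label h (permComp 0 a b) = v then
      PL.comp k 0 (φ (Finsupp.single a 1)) (alpha k (Finsupp.single b 1))
        (T.map (A.label h).symm) else 0) =
    ∑ w : Fin (p + 1 + 1), if w ∈ A.1 ∧ T.parent w ∈ A.1 ∧ T.parent w ≠ w then
      -((-1) ^ (w : ℕ) * ∑ b : {y // y ≠ w},
        if b.1 = v then coeff φ (eraseEnum (Equiv.refl _) w) b (erase T.parent w) else 0) else 0 := by
  by_cases hA : ∃ j j' : Fin 2, j ≠ j' ∧ T.parent (A.label h (.inr j')) = A.label h (.inr j)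
  · obtain ⟨j, j', hj, hp⟩ := hA
    rw [sum_comp_right (A.label h) T hj hp, Finset.sum_eq_single (A.label h (.inr j'))]
    · rw [if_pos, Finset.mul_sum, Finset.mul_sum, Finset.mul_sum, ← Finset.sum_neg_distrib]
      · refine Fintype.sum_congr _ _ fun b => ?_
        split_ifs
        · exact A.sign_mul_coeff_lower h hφ hj b _
        · simp
      · rw [hp]
        exact ⟨A.label_inr_mem h j', A.label_inr_mem h j, fun h' => hj (by simpa using h')⟩
    · rintro w - hw
      rw [if_neg]
      rintro ⟨h1, h2, h3⟩
      obtain ⟨i, rfl⟩ := A.exists_label_inr h h1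
      obtain ⟨l, hl⟩ := A.exists_label_inr h h2
      have hi : i ≠ j' := fun h' => hw (by rw [h'])
      have hij : i = j := by omega
      subst hij
      have hl' : l ≠ i := by
        rintro rfl
        exact h3 hl.symm
      have hlj : l = j' := by omega
      subst hlj
      have := T.isTree.isForest.not_two_cycle hp hl.symm
      exact hj (by simpa using this.symm)
    · simp
  · push Not at hA
    rw [sum_comp_right_eq_zero (A.label h) T hA, mul_zero, Finset.sum_eq_zero]
    rintro w -
    rw [if_neg]
    rintro ⟨h1, h2, h3⟩
    obtain ⟨i, rfl⟩ := A.exists_label_inr h h1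
    obtain ⟨l, hl⟩ := A.exists_label_inr h h2
    refine hA l i ?_ hl.symm
    rintro rfl
    exact h3 hl.symm

open Classical in
/-- The convolution product with the Maurer--Cartan element as the right factor. -/
theorem conv_apply_right (h : (1 + 1) + p = p + 1 + 1)
    {φ : ConvHom k (p + 1)} (hφ : φ ∈ Def k p) (v : Fin (p + 1 + 1)) (T : RTree (Fin (p + 1 + 1))) :
    conv h φ (alpha k) (Finsupp.single v 1) T =
      -((-1) ^ p * ∑ w : Fin (p + 1 + 1), (-1) ^ (w : ℕ) * ∑ b : {y // y ≠ w},
        if b.1 = v ∧ T.parent w ≠ w then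
          coeff φ (eraseEnum (Equiv.refl _) w) b (erase T.parent w) else 0) := by
  rw [conv_apply, Fintype.sum_congr _ _ fun A => A.sign_mul_sum_right h hφ v T, Finset.sum_comm,
    ← mul_neg, ← Finset.sum_neg_distrib]
  congr 1
  · rw [pow_mul]
    norm_num
  refine Fintype.sum_congr _ _ fun w => ?_
  by_cases hw : T.parent w = w
  · simp [hw]
  -- A vertex `w` other than the root is the source of exactly one edge, so exactly one pair
  -- contributes.
  · rw [Finset.sum_eq_single ⟨{w, T.parent w}, Finset.card_pair (Ne.symm hw)⟩]
    · simp [hw]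
    · intro A _ hA
      rw [if_neg]
      rintro ⟨h1, h2, h3⟩
      apply hA
      apply Subtype.ext
      refine (Finset.eq_of_subset_of_card_le ?_ ?_).symm
      · intro x hx
        simp only [Finset.mem_insert, Finset.mem_singleton] at hx
        rcases hx with rfl | rfl <;> assumption
      · rw [A.2]
        exact (Finset.card_pair (Ne.symm hw)).ge
    · simp

end ConvRight

/-! ### The differential as removal of vertices -/

section Differential

variable {k : Type*} [Field k] {p : ℕ} {V : Type}

/-- The condition for `f` with the marked vertex `b` and without the vertex `x` to contribute to the
differential at `f` with the marked vertex `v`: either `x` is an inner vertex, not the root, and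
`b = v`, or `x = v` is the root. -/
def IsFace (f : V → V) (v x b : V) : Prop :=
  (b = v ∧ f x ≠ x ∧ ¬ IsLeaf f x) ∨ (x = v ∧ f x = x)

-- The removals of leaves in `α ◁ φ` cancel against those in `φ ◁ α`. The removals of inner vertices
-- other than the root come only from `φ ◁ α`, and the removal of a marked root only from `α ◁ φ`:
-- by definition `α` is supported on trees with marked root.
open Classical in
theorem coeff_diff_refl {φ : ConvHom k (p + 1)} (hφ : φ ∈ Def k p) (v : Fin (p + 1 + 1))
    (T : RTree (Fin (p + 1 + 1))) :
    coeff (diff φ) (Equiv.refl _) v T.parent =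
      ∑ x : Fin (p + 1 + 1), (-1) ^ (x : ℕ) * ∑ b : {y // y ≠ x},
        if IsFace T.parent v x b then
          coeff φ (eraseEnum (Equiv.refl _) x) b (erase T.parent x) else 0 := by
  rw [coeff_refl, diff, bracket, LinearMap.sub_apply, LinearMap.smul_apply, Finsupp.sub_apply,
    Finsupp.smul_apply, conv_apply_left _ _ hφ, conv_apply_right _ hφ, smul_eq_mul, one_mul,
    mul_neg, ← mul_assoc, ← mul_pow, neg_mul_neg, one_mul, one_pow, one_mul, sub_neg_eq_add,
    ← Finset.sum_neg_distrib, ← Finset.sum_add_distrib]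
  refine Fintype.sum_congr _ _ fun x => ?_
  rw [← mul_neg, ← mul_add, ← Finset.sum_neg_distrib, ← Finset.sum_add_distrib]
  congr 1
  refine Fintype.sum_congr _ _ fun b => ?_
  generalize coeff φ (eraseEnum (Equiv.refl _) x) b (erase T.parent x) = c
  have h0 : alpha k (Finsupp.single 0 1) = Finsupp.single (RTree.corolla 0) 1 := by
    simp [alpha_single]
  have h1 : alpha k (Finsupp.single 1 1) = -Finsupp.single (RTree.corolla 1) 1 := by
    simp [alpha_single]
  have h01 : RTree.corolla (1 : Fin 2) ≠ RTree.corolla 0 := fun h =>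
    absurd (congrArg RTree.root h) (by decide : (1 : Fin 2) ≠ 0)
  rw [h0, h1]
  by_cases hx : T.parent x = x
  · by_cases hv : x = v
    · subst hv
      simp [IsFace, hx]
    · by_cases hb : b.1 = v <;> simp [IsFace, hx, hv, hb, h01.symm]
  · by_cases hv : x = v
    · subst hv
      simp [IsFace, hx, b.2, h01]
    · by_cases hb : b.1 = v <;> by_cases hl : IsLeaf T.parent x <;>
        simp [IsFace, hx, hv, hb, hl]

theorem isLeaf_conj {W : Type} (e : V ≃ W) (f : V → V) (x : V) :
    IsLeaf (e.conj f) (e x) ↔ IsLeaf f x := by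
  simp only [IsLeaf, Equiv.conj_apply, EmbeddingLike.apply_eq_iff_eq]
  refine ⟨fun h y hy => ?_, fun h y hy => ?_⟩
  · exact e.injective (h (e y) (by simpa using hy))
  · rw [← h _ hy, e.apply_symm_apply]

theorem isFace_conj {W : Type} (e : V ≃ W) (f : V → V) (v x b : V) :
    IsFace (e.conj f) (e v) (e x) (e b) ↔ IsFace f v x b := by
  simp only [IsFace, isLeaf_conj]
  simp

open Classical in
/-- The differential in terms of coefficients: the coefficient of a tree is a signed sum of
coefficients of trees with one vertex removed. -/
theorem coeff_diff [Fintype V] [DecidableEq V] {φ : ConvHom k (p + 1)} (hφ : φ ∈ Def k p)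
    (e : V ≃ Fin (p + 1 + 1)) (v : V) {f : V → V} (hf : IsTree f) :
    coeff (diff φ) e v f =
      ∑ x : V, (-1) ^ (e x : ℕ) * ∑ b : {y // y ≠ x},
        if IsFace f v x b then coeff φ (eraseEnum e x) b (erase f x) else 0 := by
  obtain ⟨T, rfl⟩ := hf
  have h := coeff_diff_refl hφ (e v) (T.map e)
  rw [show coeff (diff φ) e v T.parent = coeff (diff φ) (Equiv.refl _) (e v) (T.map e).parent from
    rfl, h, ← Equiv.sum_comp e]
  refine Fintype.sum_congr _ _ fun x => ?_
  congr 1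
  rw [← Equiv.sum_comp (e.subtypeEquiv (q := fun y => y ≠ e x)
    fun y => e.injective.ne_iff.symm)]
  refine Fintype.sum_congr _ _ fun b => ?_
  rw [show (T.map e).parent = e.conj T.parent from rfl, Equiv.subtypeEquiv_apply]
  congr 1
  · exact propext (isFace_conj e _ _ _ _)
  · rw [← erase_conj e T.parent x (fun y => e.injective.ne_iff.symm)]
    exact coeff_conj φ _ _ _ _

theorem diff_mem_Def {φ : ConvHom k (p + 1)} (hφ : φ ∈ Def k p) : diff φ ∈ Def k (p + 1) := by
  classical
  rw [mem_Def_iff]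
  intro σ v T
  rw [coeff_diff hφ _ _ T.isTree, coeff_diff hφ _ _ T.isTree, Finset.mul_sum]
  refine Fintype.sum_congr _ _ fun x => ?_
  rw [Finset.mul_sum, Finset.mul_sum, Finset.mul_sum]
  refine Fintype.sum_congr _ _ fun b => ?_
  split_ifs
  · have h := sign_firstEnum_mul_coeff hφ (Equiv.refl _) x (eraseEnum σ x) b (erase T.parent x)
    rw [← h, firstEnum_eraseEnum, show (Equiv.refl (Fin (p + 1 + 1))).symm.trans
      (σ.trans (Fin.cycleRange (σ x))) = σ.trans (Fin.cycleRange (σ x)) from rfl,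
      Equiv.Perm.sign_trans, Fin.sign_cycleRange, ← mul_assoc]
    congr 1
    rcases Int.units_eq_one_or (Equiv.Perm.sign σ) with h | h <;> simp [h]
  · simp

end Differential

/-! ### The square of the differential -/

section SquareZero

variable {k : Type*} [Field k] {p : ℕ} {V : Type}

/-- Removing a vertex that has a child does not lower the number of roots: a removed root is
replaced by its children. -/
theorem isTree_of_isTree_erase {g : V → V} (hg : IsForest g) {y : V} (hy : ¬ IsLeaf g y)
    (ht : IsTree (erase g y)) : IsTree g := by
  apply hg.isTree
  by_cases hyy : g y = y
  · refine ⟨y, hyy, fun z hz => ?_⟩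
    by_contra hzy
    simp only [IsLeaf, not_forall] at hy
    obtain ⟨c, hc, hcy⟩ := hy
    have h1 : erase g y ⟨c, hcy⟩ = ⟨c, hcy⟩ := erase_of_root hc hyy
    have h2 : erase g y ⟨z, hzy⟩ = ⟨z, hzy⟩ := by
      rw [erase_of_ne (by rwa [hz])]
      exact Subtype.ext hz
    have h3 : c = z := congrArg Subtype.val (ht.unique h1 h2)
    subst h3
    exact hzy (hz.symm.trans hc)
  · obtain ⟨r, hr, hu⟩ := ht.existsUnique
    refine ⟨r, (erase_fixed_iff hg hyy r).1 hr, fun z hz => ?_⟩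
    have hzy : z ≠ y := by
      rintro rfl
      exact hyy hz
    exact congrArg Subtype.val (hu ⟨z, hzy⟩ ((erase_fixed_iff hg hyy _).2 hz))

/-- The condition for the removal of `x` and `y` to contribute to the square of the
differential. -/
def IsDoubleFace (f : V → V) (v x y b : V) : Prop :=
  (b = v ∧ (f x ≠ x ∧ ¬ IsLeaf f x) ∧ (f y ≠ y ∧ ¬ IsLeaf f y)) ∨
    (f v = v ∧ ((x = v ∧ ¬ IsLeaf f y) ∨ (y = v ∧ ¬ IsLeaf f x)))

theorem isDoubleFace_comm (f : V → V) (v x y b : V) :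
    IsDoubleFace f v x y b ↔ IsDoubleFace f v y x b := by
  unfold IsDoubleFace
  tauto

variable [Fintype V] [DecidableEq V]

-- This rewrites two successive removals by a condition symmetric in `x` and `y`. The main case is a
-- marked root `x`: the mark then moves freely, and after summing over its intermediate position
-- every non-leaf `y` can be removed, with any final mark.
open Classical in
theorem sum_face_coeff_diff {φ : ConvHom k (p + 1)} (hφ : φ ∈ Def k p)
    (e : V ≃ Fin (p + 1 + 1 + 1)) (v x : V) {f : V → V} (hf : IsTree f) :
    (∑ b : {y // y ≠ x}, if IsFace f v x b then coeff (diff φ) (eraseEnum e x) b (erase f x)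
      else 0) =
    ∑ y : {y // y ≠ x}, (-1) ^ (eraseEnum e x y : ℕ) * ∑ b : {z // z ≠ y},
      if IsDoubleFace f v x y b.1 then
        coeff φ (eraseEnum (eraseEnum e x) y) b (erase (erase f x) y) else 0 := by
  by_cases hxv : x = v
  · subst hxv
    by_cases hx : f x = x
    · have h1 : ∀ b, IsFace f x x b := fun b => Or.inr ⟨rfl, hx⟩
      have h2 : ∀ y : {y // y ≠ x}, ∀ b : {z // z ≠ y},
          IsDoubleFace f x x y b.1 ↔ ¬ IsLeaf f y := by
        intro y b
        simp [IsDoubleFace, hx, y.2, b.1.2]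
      simp only [h1, if_true, h2]
      by_cases ht : IsTree (erase f x)
      · rw [Fintype.sum_congr _ _ fun b => coeff_diff hφ (eraseEnum e x) b ht, Finset.sum_comm]
        refine Fintype.sum_congr _ _ fun y => ?_
        rw [← Finset.mul_sum, Finset.sum_comm]
        congr 1
        refine Fintype.sum_congr _ _ fun b => ?_
        have hl := isLeaf_erase_iff (Or.inl hx) hf.isForest y
        -- Only one intermediate mark contributes: `y` itself if `y` is the new root, and the final
        -- mark `b` otherwise.
        by_cases hy : erase f x y = y
        · rw [if_pos]
          · rw [Finset.sum_eq_single y]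
            · have hface : IsFace (erase f x) y y b := Or.inr ⟨rfl, hy⟩
              rw [if_pos hface]
            · intro z _ hz
              rw [if_neg]
              rintro (h | h)
              · exact h.2.1 hy
              · exact hz h.1.symm
            · simp
          · rw [← hl]
            exact ht.not_isLeaf_root hy b.2
        · rw [Finset.sum_eq_single b.1]
          · congr 1
            rw [← hl]
            simp [IsFace, hy]
          · intro z _ hz
            rw [if_neg]
            rintro (h | h)
            · exact hz h.1.symm
            · exact hy h.2
          · simp
      -- The root has several children. Both sides vanish, since removing a further non-leaf cannot
      -- restore a tree.
      · rw [Finset.sum_eq_zero fun b _ => coeff_of_not_isTree _ _ _ ht, Finset.sum_eq_zero]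
        intro y _
        rw [Finset.sum_eq_zero, mul_zero]
        intro b _
        split_ifs with hl
        · rfl
        · apply coeff_of_not_isTree
          intro h
          refine ht (isTree_of_isTree_erase (hf.isForest.erase x) ?_ h)
          rwa [isLeaf_erase_iff (Or.inl hx) hf.isForest]
    · have h1 : ∀ b : {y // y ≠ x}, ¬ IsFace f x x b := by
        rintro b (h | h)
        · exact b.2 h.1
        · exact hx h.2
      have h2 : ∀ y : {y // y ≠ x}, ∀ b : {z // z ≠ y}, ¬ IsDoubleFace f x x y b.1 := by
        rintro y b (h | h)
        · exact b.1.2 h.1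
        · exact hx h.1
      simp [h1, h2]
  · by_cases hx : f x ≠ x ∧ ¬ IsLeaf f x
    · have h1 : ∀ b : {y // y ≠ x}, IsFace f v x b ↔ b = ⟨v, Ne.symm hxv⟩ := by
        intro b
        simp [IsFace, hxv, hx.1, hx.2, Subtype.ext_iff]
      simp only [h1]
      rw [Finset.sum_ite_eq' Finset.univ, if_pos (Finset.mem_univ _),
        coeff_diff hφ _ _ (hf.erase hx.1)]
      refine Fintype.sum_congr _ _ fun y => ?_
      congr 1
      refine Fintype.sum_congr _ _ fun b => ?_
      congr 1
      rw [IsFace, IsDoubleFace, isLeaf_erase_iff (Or.inr hx.2) hf.isForest, Ne,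
        erase_fixed_iff hf.isForest hx.1]
      simp only [Subtype.ext_iff, hx.2, hxv, eq_iff_iff]
      constructor
      · rintro (h | h)
        · exact Or.inl ⟨h.1, ⟨hx.1, by simp⟩, h.2⟩
        · exact Or.inr ⟨h.1 ▸ h.2, Or.inr ⟨h.1, by simp⟩⟩
      · rintro (h | ⟨h, h' | h'⟩)
        · exact Or.inl ⟨h.1, h.2.2⟩
        · exact h'.1.elim
        · exact Or.inr ⟨h'.1, h'.1 ▸ h⟩
    · have h1 : ∀ b : {y // y ≠ x}, ¬ IsFace f v x b := by
        rintro b (h | h)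
        · exact hx h.2
        · exact hxv h.1
      have h2 : ∀ y : {y // y ≠ x}, ∀ b : {z // z ≠ y}, ¬ IsDoubleFace f v x y b.1 := by
        rintro y b (h | ⟨h, h' | h'⟩)
        · exact hx h.2.1
        · exact hxv h'.1
        · exact hx ⟨fun h3 => hxv (hf.unique h3 h), h'.2⟩
      simp [h1, h2]

/-- A sum over ordered pairs of distinct elements vanishes if the summand is antisymmetric. -/
theorem sum_pairs_eq_zero [CharZero k] (F : (x : V) → {y : V // y ≠ x} → k)
    (hF : ∀ (x y : V) (h : y ≠ x), F x ⟨y, h⟩ = -F y ⟨x, h.symm⟩) : ∑ x, ∑ y, F x y = 0 := by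
  let swap : (Σ x : V, {y : V // y ≠ x}) ≃ (Σ x : V, {y : V // y ≠ x}) :=
    { toFun := fun s => ⟨s.2.1, s.1, s.2.2.symm⟩
      invFun := fun s => ⟨s.2.1, s.1, s.2.2.symm⟩
      left_inv := fun _ => rfl
      right_inv := fun _ => rfl }
  have h1 : ∑ x, ∑ y, F x y = ∑ s : Σ x : V, {y : V // y ≠ x}, F s.1 s.2 :=
    (Fintype.sum_sigma fun s : Σ x : V, {y : V // y ≠ x} => F s.1 s.2).symm
  have h2 : ∑ s : Σ x : V, {y : V // y ≠ x}, F s.1 s.2 =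
      -∑ s : Σ x : V, {y : V // y ≠ x}, F s.1 s.2 := by
    conv_lhs => rw [← Equiv.sum_comp swap]
    rw [← Finset.sum_neg_distrib]
    exact Fintype.sum_congr _ _ fun s => hF s.2.1 s.1 s.2.2.symm
  rw [h1]
  exact self_eq_neg.1 h2

theorem diff_diff [CharZero k] {φ : ConvHom k (p + 1)} (hφ : φ ∈ Def k p) :
    diff (diff φ) = 0 := by
  classical
  apply convHom_ext
  intro v T
  rw [coeff_zero, coeff_diff (diff_mem_Def hφ) _ _ T.isTree]
  let e := Equiv.refl (Fin (p + 1 + 1 + 1))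
  refine (Fintype.sum_congr _ _ fun x => ?_).trans (sum_pairs_eq_zero (fun x y =>
    (-1) ^ (e x : ℕ) * ((-1) ^ (eraseEnum e x y : ℕ) * ∑ b : {z // z ≠ y},
      if IsDoubleFace T.parent v x y b.1 then
        coeff φ (eraseEnum (eraseEnum e x) y) b (erase (erase T.parent x) y) else 0)) ?_)
  · rw [sum_face_coeff_diff hφ _ _ _ T.isTree, Finset.mul_sum]
  intro x y h
  rw [← mul_assoc, neg_one_pow_eraseEnum _ h, neg_mul, ← mul_assoc]
  congr 2
  rw [← Equiv.sum_comp (eraseSwap h)]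
  refine Fintype.sum_congr _ _ fun b => ?_
  rw [show (eraseSwap h b).1.1 = b.1.1 from rfl]
  congr 1
  · exact propext (isDoubleFace_comm _ _ _ _ _)
  · rw [← eraseSwap_conj_erase h, coeff_conj, eraseEnum_eraseEnum]

end SquareZero

/-! ### Insertion of a vertex into an edge -/

section Insert

variable {V W : Type}

open Classical in
/-- The parent function after the insertion of a new vertex `none` into the edge that goes
out of `t`. -/
noncomputable def ins (f : V → V) (t : V) : Option V → Option V
  | none => some (f t)
  | some y => if y = t then none else some (f y)

theorem ins_none (f : V → V) (t : V) : ins f t none = some (f t) := rfl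

theorem ins_self (f : V → V) (t : V) : ins f t (some t) = none := by simp [ins]

theorem ins_of_ne (f : V → V) {t y : V} (h : y ≠ t) : ins f t (some y) = some (f y) := by
  simp [ins, h]

theorem ins_conj (e : V ≃ W) (f : V → V) (t : V) :
    (Equiv.optionCongr e).conj (ins f t) = ins (e.conj f) (e t) := by
  ext1 z
  obtain ⟨z, rfl⟩ := (Equiv.optionCongr e).surjective z
  rw [Equiv.conj_apply, Equiv.symm_apply_apply]
  rcases z with _ | y
  · simp [ins]
  · by_cases h : y = t <;> simp [ins, h]

theorem IsForest.ins {f : V → V} (hf : IsForest f) {t : V} (ht : f t ≠ t) :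
    IsForest (ins f t) := by
  obtain ⟨ρ, hρ⟩ := hf
  -- Doubling the rank makes room for the new vertex strictly between `t` and its parent.
  refine ⟨fun z => z.elim (2 * ρ t) fun y => 2 * ρ y + 1, fun z hz => ?_⟩
  rcases z with _ | y
  · have := hρ t ht
    simp only [ins_none, Option.elim]
    omega
  · by_cases h : y = t
    · subst h
      simp [ins_self]
    · rw [ins_of_ne f h] at hz ⊢
      have := hρ y (by simpa using hz)
      simp only [Option.elim]
      omega

/-- The vertices other than the new one. -/
def someEquiv : V ≃ {z : Option V // z ≠ none} where
  toFun y := ⟨some y, by simp⟩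
  invFun z := z.1.get (Option.isSome_iff_ne_none.2 z.2)
  left_inv _ := rfl
  right_inv z := by simp

theorem someEquiv_conj (f : V → V) (t : V) : someEquiv.conj f = erase (ins f t) none := by
  ext1 z
  obtain ⟨y, rfl⟩ := someEquiv.surjective z
  rw [Equiv.conj_apply, Equiv.symm_apply_apply]
  change _ = erase (ins f t) none ⟨some y, by simp⟩
  by_cases h : y = t
  · subst h
    rw [erase_of_eq (ins_self f y) (by simp [ins_none])]
    rfl
  · rw [erase_of_ne (by simp [ins_of_ne f h])]
    exact Subtype.ext (ins_of_ne f h).symm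

theorem isTree_ins_iff {f : V → V} (hf : IsForest f) {t : V} (ht : f t ≠ t) :
    IsTree (ins f t) ↔ IsTree f := by
  rw [← isTree_conj_iff (f := f) someEquiv, someEquiv_conj f t]
  refine ⟨fun h => h.erase (by simp [ins_none]), isTree_of_isTree_erase (hf.ins ht) fun h => ?_⟩
  simpa using h _ (ins_self f t)

theorem ins_fixed_iff {f : V → V} {t : V} (ht : f t ≠ t) (x : V) :
    ins f t (some x) = some x ↔ f x = x := by
  by_cases h : x = t
  · subst h
    simp [ins_self, ht]
  · simp [ins_of_ne f h]

/-- The parent of `t` exchanges its child `t` for the new vertex, so it stays inner, and `t` itself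
gains no child. -/
theorem isLeaf_ins_iff {f : V → V} {t : V} (ht : f t ≠ t) (hl : IsLeaf f t) (x : V) :
    IsLeaf (ins f t) (some x) ↔ IsLeaf f x := by
  constructor
  · intro h y hy
    by_cases hyt : y = t
    · subst hyt
      simpa using h none (by rw [ins_none, hy])
    · simpa using h (some y) (by rw [ins_of_ne f hyt, hy])
  · rintro h (_ | y) hz
    · rw [ins_none, Option.some_inj] at hz
      have := h t hz
      exact absurd (hz.trans this.symm) ht
    · by_cases hyt : y = t
      · subst hyt
        simp [ins_self] at hz
      · rw [ins_of_ne f hyt, Option.some_inj] at hz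
        rw [h y hz]

theorem isFace_ins_iff {f : V → V} {t : V} (ht : f t ≠ t) (hl : IsLeaf f t) (v x : V)
    (z : Option V) :
    IsFace (ins f t) (some v) (some x) z ↔
      (z = some v ∧ f x ≠ x ∧ ¬ IsLeaf f x) ∨ (x = v ∧ f x = x) := by
  rw [IsFace, Ne, ins_fixed_iff ht, isLeaf_ins_iff ht hl, Option.some_inj]

/-- The vertices other than an old one, after an insertion. -/
def skipEquiv (x : V) : Option {y : V // y ≠ x} ≃ {z : Option V // z ≠ some x} where
  toFun z := ⟨z.map Subtype.val, by rcases z with _ | ⟨y, hy⟩ <;> simp_all⟩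
  invFun
    | ⟨none, _⟩ => none
    | ⟨some y, h⟩ => some ⟨y, fun h' => h (congrArg some h')⟩
  left_inv z := by rcases z with _ | y <;> rfl
  right_inv z := by rcases z with ⟨_ | y, h⟩ <;> rfl

/-- Insertion below `t` and removal of `x` commute unless `x` is the root and the parent of `t`. In
that excluded case `t` becomes a root, with no outgoing edge to insert into, whereas on the other
side the new vertex becomes a root. -/
theorem skipEquiv_conj_ins {f : V → V} {t x : V} (htx : t ≠ x) (h : f t ≠ x ∨ f x ≠ x) :
    (skipEquiv x).conj (ins (erase f x) ⟨t, htx⟩) = erase (ins f t) (some x) := by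
  have hx : ins f t (some x) = some (f x) := ins_of_ne f htx.symm
  ext1 z
  obtain ⟨z, rfl⟩ := (skipEquiv x).surjective z
  rw [Equiv.conj_apply, Equiv.symm_apply_apply]
  apply Subtype.ext
  rcases z with _ | y
  · rw [ins_none]
    by_cases h1 : f t = x
    · have h2 : f x ≠ x := h.resolve_left (not_not.2 h1)
      rw [erase_of_eq (f := ins f t) (by change ins f t none = _; rw [ins_none, h1])
        (by simpa [hx] using h2), erase_of_eq (y := ⟨t, htx⟩) h1 h2]
      exact hx.symm
    · rw [erase_of_ne (f := ins f t) (by change ins f t none ≠ _; simpa [ins_none] using h1),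
        erase_of_ne (y := ⟨t, htx⟩) h1]
      rfl
  · by_cases hy : y = ⟨t, htx⟩
    · subst hy
      rw [ins_self, erase_of_ne (f := ins f t) (by change ins f t (some t) ≠ _; simp [ins_self])]
      exact (ins_self f t).symm
    · have hyt : y.1 ≠ t := fun h' => hy (Subtype.ext h')
      have hiy : ins f t (skipEquiv x (some y)).1 = some (f y) := ins_of_ne f hyt
      rw [ins_of_ne _ hy]
      by_cases h1 : f y = x
      · by_cases h2 : f x = x
        · rw [erase_of_root (f := ins f t) (by rw [hiy, h1]) (by rw [hx, h2]),
            erase_of_root h1 h2]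
        · rw [erase_of_eq (f := ins f t) (by rw [hiy, h1]) (by simpa [hx] using h2),
            erase_of_eq h1 h2]
          exact hx.symm
      · rw [erase_of_ne (f := ins f t) (by simpa [hiy] using h1), erase_of_ne h1]
        exact hiy.symm

theorem someEquiv_trans_eraseEnum {n : ℕ} (e : V ≃ Fin n) :
    someEquiv.trans (eraseEnum (consEnum e) none) = e := by
  ext1 y
  have h := succAbove_eraseEnum (consEnum e) none (someEquiv y)
  rw [consEnum_none, show (someEquiv y).1 = some y from rfl, consEnum_some, Fin.succAbove_zero] at h
  exact Fin.succ_injective _ h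

theorem skipEquiv_trans_eraseEnum {n : ℕ} (e : V ≃ Fin (n + 1)) (x : V) :
    (skipEquiv x).trans (eraseEnum (consEnum e) (some x)) = consEnum (eraseEnum e x) := by
  ext1 z
  have h := succAbove_eraseEnum (consEnum e) (some x) (skipEquiv x z)
  rw [consEnum_some] at h
  apply Fin.succAbove_right_injective (p := (e x).succ)
  rw [Equiv.trans_apply, h]
  rcases z with _ | y
  · change consEnum e none = _
    simp
  · change consEnum e (some y) = _
    rw [consEnum_some, consEnum_some, Fin.succ_succAbove_succ, succAbove_eraseEnum]

end Insert

/-! ### Leaves of a forest -/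

section Leaves

variable {V : Type} [Fintype V] [DecidableEq V]

theorem IsForest.exists_isLeaf [Nonempty V] {f : V → V} (hf : IsForest f) : ∃ t, IsLeaf f t := by
  obtain ⟨ρ, hρ⟩ := hf
  obtain ⟨t, ht⟩ := Finite.exists_max ρ
  refine ⟨t, fun y hy => ?_⟩
  by_contra hne
  have := hρ y (by rw [hy]; exact Ne.symm hne)
  rw [hy] at this
  exact absurd (ht y) (not_le.2 this)

open Classical in
theorem sum_leaves_erase {M : Type*} [AddCommMonoid M] {f : V → V} (hf : IsForest f) {x : V}
    (hx : ¬ IsLeaf f x) (F : V → M) :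
    (∑ t, if IsLeaf f t then F t else 0) =
      ∑ s : {y // y ≠ x}, if IsLeaf (erase f x) s then F s else 0 := by
  rw [Fintype.sum_eq_add_sum_subtype_ne _ x, if_neg hx, zero_add]
  refine Fintype.sum_congr _ _ fun s => ?_
  congr 1
  exact propext (isLeaf_erase_iff (Or.inr hx) hf s).symm

open Classical in
/-- The number of leaves. -/
noncomputable def numLeaves (f : V → V) : ℕ := ∑ t, if IsLeaf f t then 1 else 0

theorem numLeaves_erase {f : V → V} (hf : IsForest f) {x : V} (hx : ¬ IsLeaf f x) :
    numLeaves (erase f x) = numLeaves f := (sum_leaves_erase hf hx fun _ => 1).symm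

theorem numLeaves_ne_zero [Nonempty V] {f : V → V} (hf : IsForest f) : numLeaves f ≠ 0 := by
  obtain ⟨t, ht⟩ := hf.exists_isLeaf
  intro h
  have := (Finset.sum_eq_zero_iff.1 h) t (Finset.mem_univ t)
  simp [ht] at this

end Leaves

/-! ### The contracting homotopy -/

section Homotopy

variable {k : Type*} [Field k] {p : ℕ} {V : Type}

open Classical in
/-- The contracting homotopy: insert a new vertex above a leaf, and average over the leaves. -/
noncomputable def homotopy (φ : ConvHom k (p + 1)) : ConvHom k p :=
  ofCoeff fun v T => (numLeaves T.parent : k)⁻¹ * ∑ t, if IsLeaf T.parent t then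
    coeff φ (consEnum (Equiv.refl _)) (some v) (ins T.parent t) else 0

variable [Fintype V]

open Classical in
theorem coeff_homotopy (φ : ConvHom k (p + 1)) (e : V ≃ Fin p) (v : V) {f : V → V}
    (hf : IsTree f) :
    coeff (homotopy φ) e v f = (numLeaves f : k)⁻¹ * ∑ t, if IsLeaf f t then
      coeff φ (consEnum e) (some v) (ins f t) else 0 := by
  obtain ⟨T, rfl⟩ := hf
  rw [show coeff (homotopy φ) e v T.parent =
    coeff (homotopy φ) (Equiv.refl _) (e v) (T.map e).parent from rfl, coeff_refl, homotopy,
    ofCoeff_single]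
  have h1 : numLeaves (T.map e).parent = numLeaves T.parent := by
    unfold numLeaves
    rw [← Equiv.sum_comp e]
    exact Fintype.sum_congr _ _ fun t => if_congr (isLeaf_conj e T.parent t) rfl rfl
  rw [h1, ← Equiv.sum_comp e]
  congr 1
  refine Fintype.sum_congr _ _ fun t => if_congr (isLeaf_conj e T.parent t) ?_ rfl
  have h2 : (Equiv.optionCongr e).trans (consEnum (Equiv.refl _)) = consEnum e := by
    ext1 z
    rcases z with _ | y <;> simp
  rw [show (T.map e).parent = e.conj T.parent from rfl, ← ins_conj, ← h2]
  exact coeff_conj φ (Equiv.optionCongr e) (consEnum (Equiv.refl _)) (some v) _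

theorem homotopy_mem_Def {φ : ConvHom k (p + 1 + 1)} (hφ : φ ∈ Def k (p + 1)) :
    homotopy φ ∈ Def k p := by
  classical
  rw [mem_Def_iff]
  intro σ v T
  rw [coeff_homotopy φ _ _ T.isTree, coeff_homotopy φ _ _ T.isTree, mul_left_comm]
  congr 1
  rw [Finset.mul_sum]
  refine Fintype.sum_congr _ _ fun t => ?_
  rw [show consEnum σ = consEnum ((Equiv.refl _).trans σ) from rfl, consEnum_trans,
    coeff_trans hφ, sign_consPerm, mul_ite, mul_zero]

end Homotopy

/-! ### The homotopy formula -/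

section Contraction

variable {k : Type*} [Field k] {p : ℕ} {V : Type}

/-- The map has no coefficients at trees whose root is not marked. -/
def RootMarked (φ : ConvHom k p) : Prop :=
  ∀ (v : Fin p) (T : RTree (Fin p)), T.parent v ≠ v → coeff φ (Equiv.refl _) v T.parent = 0

theorem RootMarked.coeff_eq_zero {φ : ConvHom k p} (hφ : RootMarked φ) (e : V ≃ Fin p) {v : V}
    {f : V → V} (hv : f v ≠ v) : coeff φ e v f = 0 := by
  by_cases hf : IsTree f
  · obtain ⟨T, rfl⟩ := hf
    refine hφ (e v) (T.map e) fun h => hv ?_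
    simpa [RTree.map] using h
  · exact coeff_of_not_isTree _ _ _ hf

theorem IsTree.not_fixed_of_isLeaf [Nontrivial V] {f : V → V} (hf : IsTree f) {t : V}
    (ht : IsLeaf f t) : f t ≠ t := by
  intro h
  obtain ⟨y, hy⟩ := exists_ne t
  exact hf.not_isLeaf_root h hy ht

theorem coeff_erase_ins {n : ℕ} (φ : ConvHom k (n + 1)) (e : V ≃ Fin (n + 1)) {f : V → V} {t x : V}
    (htx : t ≠ x) (h : f t ≠ x ∨ f x ≠ x) (z : Option {y : V // y ≠ x}) :
    coeff φ (eraseEnum (consEnum e) (some x)) (skipEquiv x z) (erase (ins f t) (some x)) =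
      coeff φ (consEnum (eraseEnum e x)) z (ins (erase f x) ⟨t, htx⟩) := by
  rw [← skipEquiv_conj_ins htx h, coeff_conj, skipEquiv_trans_eraseEnum]

/-- If the removal of the root does not give a tree, then neither does its removal after
an insertion above a leaf. -/
theorem not_isTree_erase_ins {f : V → V} (hf : IsTree f) {v t : V} (hv : f v = v) (htv : t ≠ v)
    (hn : ¬ IsTree (erase f v)) : ¬ IsTree (erase (ins f t) (some v)) := by
  have hiv : ins f t (some v) = some v := by rw [ins_of_ne f htv.symm, hv]
  by_cases h : f t = v
  · intro hT
    apply hn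
    refine (hf.isForest.erase v).isTree ⟨⟨t, htv⟩, erase_of_root h hv, fun z hz => ?_⟩
    by_contra hzt
    have hzt' : z.1 ≠ t := fun h' => hzt (Subtype.ext h')
    have h1 : erase (ins f t) (some v) ⟨none, by simp⟩ = ⟨none, by simp⟩ :=
      erase_of_root (by change ins f t none = _; rw [ins_none, h]) hiv
    have h2 : erase (ins f t) (some v) ⟨some z, by simpa using z.2⟩ = ⟨some z, by simpa using z.2⟩ :=
      erase_of_root (by
        change ins f t (some z) = _
        rw [ins_of_ne f hzt', (erase_root_fixed_iff hf hv z).1 hz]) hiv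
    have := congrArg Subtype.val (hT.unique h1 h2)
    simp at this
  · have h1 : erase f v ⟨t, htv⟩ ≠ ⟨t, htv⟩ := by
      rw [Ne, erase_root_fixed_iff hf hv]
      exact h
    rwa [← skipEquiv_conj_ins htv (Or.inl h), isTree_conj_iff,
      isTree_ins_iff (hf.isForest.erase v) h1]

variable [Fintype V] [DecidableEq V]

-- For each removed vertex `x`, removal commutes with the averaged insertion. The assumption `hv`
-- matters only if `x = v` is the root: then the mark may move to the new vertex, and this extra
-- term has to vanish.
open Classical in
theorem sum_face_coeff_homotopy {φ : ConvHom k (p + 1 + 1)}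
    (e : V ≃ Fin (p + 1 + 1)) {v : V} (x : V) {f : V → V} (hf : IsTree f)
    (hv : f v ≠ v ∨ (RootMarked φ ∧ 0 < p)) :
    (∑ b : {y // y ≠ x}, if IsFace f v x b then
      coeff (homotopy φ) (eraseEnum e x) b (erase f x) else 0) =
    (numLeaves f : k)⁻¹ * ∑ t, if IsLeaf f t then
      ∑ z : {z // z ≠ some x}, (if IsFace (ins f t) (some v) (some x) z then
        coeff φ (eraseEnum (consEnum e) (some x)) z (erase (ins f t) (some x)) else 0) else 0 := by
  have : Nontrivial V := e.nontrivial
  have hleaf : ∀ t, IsLeaf f t → f t ≠ t := fun t => hf.not_fixed_of_isLeaf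
  by_cases hx : f x ≠ x ∧ ¬ IsLeaf f x
  · rw [sum_leaves_erase hf.isForest hx.2]
    by_cases hxv : x = v
    · subst hxv
      rw [Finset.sum_eq_zero, Finset.sum_eq_zero, mul_zero]
      · intro s _
        split_ifs with hs
        · rw [isLeaf_erase_iff (Or.inr hx.2) hf.isForest] at hs
          refine Finset.sum_eq_zero fun z _ => if_neg ?_
          rw [isFace_ins_iff (hleaf s hs) hs]
          rintro (h | h)
          · exact z.2 h.1
          · exact hx.1 h.2
        · rfl
      · rintro b -
        rw [if_neg]
        rintro (h | h)
        · exact b.2 h.1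
        · exact hx.1 h.2
    · have hface : IsFace f v x v := Or.inl ⟨rfl, hx⟩
      rw [Finset.sum_eq_single ⟨v, Ne.symm hxv⟩, if_pos hface,
        coeff_homotopy _ _ _ (hf.erase hx.1), numLeaves_erase hf.isForest hx.2]
      · congr 1
        refine Fintype.sum_congr _ _ fun s => ?_
        split_ifs with hs
        · rw [isLeaf_erase_iff (Or.inr hx.2) hf.isForest] at hs
          rw [← Equiv.sum_comp (skipEquiv x), Finset.sum_eq_single (some ⟨v, Ne.symm hxv⟩), if_pos,
            coeff_erase_ins φ e s.2 (Or.inr hx.1)]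
          · rw [isFace_ins_iff (hleaf s hs) hs]
            exact Or.inl ⟨rfl, hx⟩
          · intro z _ hz
            rw [if_neg]
            rw [isFace_ins_iff (hleaf s hs) hs]
            rintro (h | h)
            · apply hz
              apply (skipEquiv x).injective
              exact Subtype.ext h.1
            · exact hxv h.1
          · simp
        · rfl
      · intro b _ hb
        rw [if_neg]
        rintro (h | h)
        · exact hb (Subtype.ext h.1)
        · exact hxv h.1
      · simp
  · by_cases hxv : x = v ∧ f x = x
    · obtain ⟨rfl, hxx⟩ := hxv
      obtain ⟨hroot, hp⟩ := hv.resolve_left (not_not.2 hxx)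
      have hxl : ¬ IsLeaf f x := fun h => hleaf x h hxx
      have hface : ∀ b, IsFace f x x b := fun b => Or.inr ⟨rfl, hxx⟩
      simp only [hface, if_true]
      rw [sum_leaves_erase hf.isForest hxl]
      by_cases hT : IsTree (erase f x)
      -- At least two vertices remain, so a leaf of the remaining tree is not its root and was not a
      -- child of `x`; insertion and removal therefore commute.
      · have : Nontrivial {y // y ≠ x} := by
          obtain ⟨q, rfl⟩ : ∃ q, p = q + 1 := ⟨p - 1, by omega⟩
          exact (eraseEnum e x).nontrivial
        rw [Fintype.sum_congr _ _ fun b => coeff_homotopy φ (eraseEnum e x) b hT, ← Finset.mul_sum,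
          numLeaves_erase hf.isForest hxl, Finset.sum_comm]
        congr 1
        refine Fintype.sum_congr _ _ fun s => ?_
        by_cases hs : IsLeaf (erase f x) s
        · have hs' : IsLeaf f s := (isLeaf_erase_iff (Or.inr hxl) hf.isForest s).1 hs
          have hfs : f s ≠ x := by
            have := hT.not_fixed_of_isLeaf hs
            rwa [Ne, erase_root_fixed_iff hf hxx] at this
          simp only [if_pos hs]
          rw [← Equiv.sum_comp (skipEquiv x), Fintype.sum_option]
          have hface' : ∀ z, IsFace (ins f s) (some x) (some x) z := by
            intro z
            rw [isFace_ins_iff (hleaf s hs') hs']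
            exact Or.inr ⟨rfl, hxx⟩
          simp only [hface', if_true, coeff_erase_ins φ e s.2 (Or.inl hfs)]
          -- The extra term, with the mark at the new vertex, which is not the root.
          rw [hroot.coeff_eq_zero (v := none) _ (by simp [ins_none]), zero_add]
        · simp [hs]
      · rw [Finset.sum_eq_zero fun b _ => coeff_of_not_isTree _ _ _ hT, Finset.sum_eq_zero,
          mul_zero]
        intro s _
        split_ifs with hs
        · rw [isLeaf_erase_iff (Or.inr hxl) hf.isForest] at hs
          refine Finset.sum_eq_zero fun z _ => ?_
          rw [coeff_of_not_isTree _ _ _ (not_isTree_erase_ins hf hxx s.2 hT), ite_self]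
        · rfl
    · rw [Finset.sum_eq_zero, Finset.sum_eq_zero, mul_zero]
      · intro t _
        split_ifs with ht
        · refine Finset.sum_eq_zero fun z _ => if_neg ?_
          rw [isFace_ins_iff (hleaf t ht) ht]
          rintro (h | h)
          · exact hx h.2
          · exact hxv h
        · rfl
      · rintro b -
        rw [if_neg]
        rintro (h | h)
        · exact hx h.2
        · exact hxv h

/-- The homotopy formula for cocycles. -/
theorem coeff_diff_homotopy [CharZero k] {φ : ConvHom k (p + 1 + 1)} (hφ : φ ∈ Def k (p + 1))
    (hd : diff φ = 0) (e : V ≃ Fin (p + 1 + 1)) {v : V} {f : V → V} (hf : IsTree f)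
    (hv : f v ≠ v ∨ (RootMarked φ ∧ 0 < p)) :
    coeff (diff (homotopy φ)) e v f = coeff φ e v f := by
  classical
  have : Nontrivial V := e.nontrivial
  have hL : (numLeaves f : k) ≠ 0 := Nat.cast_ne_zero.2 (numLeaves_ne_zero hf.isForest)
  rw [coeff_diff (homotopy_mem_Def hφ) e v hf]
  have key : ∀ t, IsLeaf f t → ∑ x, (-1) ^ (e x : ℕ) * ∑ z : {z // z ≠ some x},
      (if IsFace (ins f t) (some v) (some x) z then
        coeff φ (eraseEnum (consEnum e) (some x)) z (erase (ins f t) (some x)) else 0) =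
      coeff φ e v f := by
    intro t ht
    have htt := hf.not_fixed_of_isLeaf ht
    -- The cocycle condition at the enlarged tree, split into the removal of the new vertex and the
    -- removals of old ones.
    have h0 := coeff_diff hφ (consEnum e) (some v) ((isTree_ins_iff hf.isForest htt).2 hf)
    rw [hd, coeff_zero, Fintype.sum_option] at h0
    have h1 : ∑ b : {z // z ≠ none}, (if IsFace (ins f t) (some v) none b then
        coeff φ (eraseEnum (consEnum e) none) b (erase (ins f t) none) else 0) =
        coeff φ e v f := by
      rw [← someEquiv_conj f t, Finset.sum_eq_single (someEquiv v), if_pos, coeff_conj,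
        someEquiv_trans_eraseEnum]
      · refine Or.inl ⟨rfl, by simp [ins_none], fun h => ?_⟩
        simpa using h _ (ins_self f t)
      · intro b _ hb
        rw [if_neg]
        rintro (h | h)
        · exact hb (Subtype.ext h.1)
        · simp at h
      · simp
    rw [h1] at h0
    -- The new vertex has number `0`, hence sign `1`; the old ones are shifted by one, so their
    -- signs are reversed and their sum moves to the other side with the original signs.
    simp only [consEnum_none, Fin.val_zero, pow_zero, one_mul, consEnum_some, Fin.val_succ,
      pow_succ, mul_neg, mul_one, neg_mul, Finset.sum_neg_distrib] at h0
    exact (eq_of_sub_eq_zero (by rw [sub_eq_add_neg]; exact h0.symm)).symm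
  calc _ = ∑ x, (numLeaves f : k)⁻¹ * ∑ t, if IsLeaf f t then (-1) ^ (e x : ℕ) *
        ∑ z : {z // z ≠ some x}, (if IsFace (ins f t) (some v) (some x) z then
          coeff φ (eraseEnum (consEnum e) (some x)) z (erase (ins f t) (some x)) else 0) else 0 := by
        refine Fintype.sum_congr _ _ fun x => ?_
        rw [sum_face_coeff_homotopy e x hf hv, mul_left_comm, Finset.mul_sum]
        simp only [mul_ite, mul_zero]
    _ = (numLeaves f : k)⁻¹ * ∑ t, if IsLeaf f t then coeff φ e v f else 0 := by
        rw [← Finset.mul_sum, Finset.sum_comm]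
        congr 1
        refine Fintype.sum_congr _ _ fun t => ?_
        by_cases ht : IsLeaf f t
        · simp only [if_pos ht]
          exact key t ht
        · simp [ht]
    _ = coeff φ e v f := by
        have : (∑ t, if IsLeaf f t then coeff φ e v f else 0) =
            (numLeaves f : k) * coeff φ e v f := by
          rw [numLeaves, Nat.cast_sum, Finset.sum_mul]
          refine Fintype.sum_congr _ _ fun t => ?_
          split_ifs <;> simp
        rw [this, inv_mul_cancel_left₀ hL]

end Contraction

/-! ### Linearity of the differential -/

section Linearity

variable {k : Type*} [Field k] {n m N p : ℕ}

theorem conv_add_left (h : m + n = N) (φ φ' : ConvHom k (n + 1)) (ψ : ConvHom k m) :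
    conv h (φ + φ') ψ = conv h φ ψ + conv h φ' ψ := by
  simp only [conv, TensorProduct.map_add_left, LinearMap.add_comp, LinearMap.comp_add, smul_add,
    Finset.sum_add_distrib]

theorem conv_add_right (h : m + n = N) (φ : ConvHom k (n + 1)) (ψ ψ' : ConvHom k m) :
    conv h φ (ψ + ψ') = conv h φ ψ + conv h φ ψ' := by
  simp only [conv, TensorProduct.map_add_right, LinearMap.add_comp, LinearMap.comp_add, smul_add,
    Finset.sum_add_distrib]

theorem conv_smul_left (h : m + n = N) (c : k) (φ : ConvHom k (n + 1)) (ψ : ConvHom k m) :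
    conv h (c • φ) ψ = c • conv h φ ψ := by
  simp only [conv, TensorProduct.map_smul_left, LinearMap.smul_comp, LinearMap.comp_smul,
    Finset.smul_sum, smul_comm c]

theorem conv_smul_right (h : m + n = N) (c : k) (φ : ConvHom k (n + 1)) (ψ : ConvHom k m) :
    conv h φ (c • ψ) = c • conv h φ ψ := by
  simp only [conv, TensorProduct.map_smul_right, LinearMap.smul_comp, LinearMap.comp_smul,
    Finset.smul_sum, smul_comm c]

theorem diff_add (φ ψ : ConvHom k (p + 1)) : diff (φ + ψ) = diff φ + diff ψ := by
  simp only [diff, bracket, conv_add_left, conv_add_right, smul_add]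
  abel

theorem diff_smul (c : k) (φ : ConvHom k (p + 1)) : diff (c • φ) = c • diff φ := by
  refine convHom_ext fun v T => ?_
  simp only [diff, bracket, conv_smul_left, conv_smul_right, coeff_sub, coeff_smul]
  ring

end Linearity

/-! ### Arities one and two, and the Maurer–Cartan equation -/

section LowArity

variable {k : Type*} [Field k]

theorem RTree.eq_corolla (T : RTree (Fin 2)) : T = RTree.corolla T.root := by
  apply RTree.ext_parent
  ext1 x
  change T.parent x = T.root
  by_cases hx : x = T.root
  · rw [hx, T.parent_root]
  · have h := mt T.parent_eq_self_iff.1 hx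
    omega

theorem isTree_of_subsingleton {V : Type} [Subsingleton V] (v : V) (f : V → V) : IsTree f :=
  ⟨⟨v, f, Subsingleton.elim _ _, fun _ => ⟨0, Subsingleton.elim _ _⟩⟩, rfl⟩

variable (k) in
/-- The counit of the cooperad followed by the unit of the operad. -/
noncomputable def unitHom : ConvHom k (0 + 1) := ofCoeff fun _ _ => 1

theorem coeff_unitHom {V : Type} (e : V ≃ Fin (0 + 1)) (v : V) (f : V → V) :
    coeff (unitHom k) e v f = 1 := by
  have : Subsingleton V := (show V ≃ Fin 1 from e).subsingleton
  obtain ⟨T, rfl⟩ := isTree_of_subsingleton v f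
  rw [show coeff (unitHom k) e v T.parent =
    coeff (unitHom k) (Equiv.refl _) (e v) (T.map e).parent from rfl, coeff_refl, unitHom,
    ofCoeff_single]

theorem unitHom_mem_Def : unitHom k ∈ Def k 0 := by
  rw [mem_Def_iff]
  intro σ v T
  have : Subsingleton (Fin (0 + 1)) := inferInstanceAs (Subsingleton (Fin 1))
  rw [coeff_unitHom, coeff_unitHom, Subsingleton.elim σ 1]
  simp

theorem eq_smul_unitHom (φ : ConvHom k (0 + 1)) : ∃ a : k, φ = a • unitHom k := by
  have : Subsingleton (Fin (0 + 1)) := inferInstanceAs (Subsingleton (Fin 1))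
  refine ⟨coeff φ (Equiv.refl _) 0 id, convHom_ext fun v T => ?_⟩
  rw [coeff_smul, coeff_unitHom, mul_one, Subsingleton.elim v 0, Subsingleton.elim T.parent id]

theorem alpha_apply_corolla (x : PLDual k 2) (v : Fin 2) :
    alpha k x (RTree.corolla v) = (-1) ^ (v : ℕ) * x v := by
  induction x using Finsupp.induction_linear with
  | zero => simp
  | add x y hx hy => rw [map_add, Finsupp.add_apply, hx, hy, Finsupp.add_apply, mul_add]
  | single w a =>
    rw [show Finsupp.single w a = a • Finsupp.single w (1 : k) by simp, map_smul, alpha_single]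
    by_cases h : w = v
    · subst h
      simp [mul_comm]
    · have h' : RTree.corolla w ≠ RTree.corolla v := fun h' => h (congrArg RTree.root h')
      simp [h, h']

/-- A tree with two vertices has no inner vertex besides its root, so only the removal of a marked
root contributes; its sign is the one in `α`. -/
theorem diff_unitHom : diff (unitHom k) = alpha k := by
  classical
  apply convHom_ext
  intro v T
  rw [coeff_diff unitHom_mem_Def _ _ T.isTree, coeff_refl]
  obtain ⟨r, rfl⟩ : ∃ r, T = RTree.corolla r := ⟨_, RTree.eq_corolla T⟩
  rw [alpha_apply_corolla]
  have hface : ∀ x b : Fin 2, b ≠ x → (IsFace (RTree.corolla r).parent v x b ↔ x = v ∧ r = x) := by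
    intro x b hb
    refine ⟨?_, fun h => Or.inr h⟩
    rintro (h | h)
    · exact absurd (fun y hy => absurd hy h.2.1) h.2.2
    · exact h
  have hcard : ∀ x : Fin (0 + 1 + 1), Fintype.card {y // y ≠ x} = 1 := fun x => by
    rw [Fintype.card_congr (eraseEnum (Equiv.refl _) x)]
    simp
  rw [Finset.sum_eq_single v]
  · rw [Fintype.sum_congr _ _ fun b : {y // y ≠ v} => if_congr (hface v b.1 b.2) (coeff_unitHom _ _ _) rfl,
      Finset.sum_const, Finset.card_univ, hcard, one_smul]
    by_cases h : r = v
    · subst h; simp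
    · simp [h]
  · intro x _ hx
    rw [Finset.sum_eq_zero, mul_zero]
    intro b _
    rw [if_neg]
    rw [hface x b b.2]
    exact fun h => hx h.1
  · simp

theorem alpha_mem_Def : alpha k ∈ Def k 1 := diff_unitHom (k := k) ▸ diff_mem_Def unitHom_mem_Def

theorem coeff_const {n : ℕ} {V : Type} (φ : ConvHom k n) (e : V ≃ Fin n) (v c : V) :
    coeff φ e v (fun _ => c) = φ (Finsupp.single (e v) 1) (RTree.corolla (e c)) :=
  val_parent _ (RTree.corolla (e c))

theorem apply_single_one {φ : ConvHom k 2} (hφ : φ ∈ Def k 1) (r : Fin 2) :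
    φ (Finsupp.single 1 1) (RTree.corolla (Equiv.swap 0 1 r)) =
      -φ (Finsupp.single 0 1) (RTree.corolla r) := by
  have h := mem_Def_iff.1 hφ (Equiv.swap 0 1) 0 (RTree.corolla r)
  rw [Equiv.Perm.sign_swap (by decide), coeff_refl] at h
  rw [show (RTree.corolla r).parent = fun _ => r from rfl, coeff_const, Equiv.swap_apply_left] at h
  rw [h]
  simp

theorem eq_smul_alpha {φ : ConvHom k 2} (hφ : φ ∈ Def k 1)
    (h : φ (Finsupp.single 0 1) (RTree.corolla 1) = 0) :
    φ = φ (Finsupp.single 0 1) (RTree.corolla 0) • alpha k := by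
  have h0 : φ (Finsupp.single 1 1) (RTree.corolla 1) =
      -φ (Finsupp.single 0 1) (RTree.corolla 0) := apply_single_one hφ 0
  have h1 : φ (Finsupp.single 1 1) (RTree.corolla 0) =
      -φ (Finsupp.single 0 1) (RTree.corolla 1) := apply_single_one hφ 1
  apply convHom_ext
  intro v T
  rw [RTree.eq_corolla T, coeff_refl, coeff_refl, LinearMap.smul_apply, Finsupp.smul_apply,
    alpha_apply_corolla]
  generalize T.root = r
  fin_cases v <;> fin_cases r <;> simp [h, h0, h1]

/-- Let `a` and `b` be the values of `φ` at mark `0` with root `0` and with root `1`. In the corolla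
with root `0` and mark `1`, removing the root leaves no tree, the leaf `1` contributes `-b * (a -
b)` and the leaf `2` contributes `a * b`, so the mixed terms cancel. -/
theorem conv_self_apply {φ : ConvHom k (1 + 1)} (hφ : φ ∈ Def k 1) :
    conv (show (1 + 1) + 1 = 1 + 1 + 1 from rfl) φ φ (Finsupp.single 1 1) (RTree.corolla 0) =
      φ (Finsupp.single 0 1) (RTree.corolla 1) ^ 2 := by
  classical
  have h1 : φ (Finsupp.single 1 1) (RTree.corolla 0) =
      -φ (Finsupp.single 0 1) (RTree.corolla 1) := apply_single_one hφ 1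
  rw [conv_apply_left _ _ hφ]
  set f : Fin (1 + 1 + 1) → Fin (1 + 1 + 1) := (RTree.corolla 0).parent with hf
  have hf0 : ∀ x, f x = 0 := fun _ => rfl
  have hleaf : ∀ x, x ≠ 0 → IsLeaf f x := fun x hx y hy => absurd hy.symm hx
  have hnot : ¬ IsTree (erase f 0) := by
    intro h
    have := h.unique (x := ⟨1, by decide⟩) (y := ⟨2, by decide⟩) (erase_of_root rfl rfl)
      (erase_of_root rfl rfl)
    simp [Subtype.ext_iff] at this
  have herase : ∀ (x : Fin (1 + 1 + 1)) (hx : x ≠ 0) (b : {y // y ≠ x}),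
      coeff φ (eraseEnum (Equiv.refl _) x) b (erase f x) =
        φ (Finsupp.single (eraseEnum (Equiv.refl _) x b) 1) (RTree.corolla 0) := by
    intro x hx b
    have h2 : erase f x = fun _ => ⟨0, hx.symm⟩ := by
      ext1 y
      exact erase_of_ne hx.symm
    have h3 : eraseEnum (Equiv.refl _) x ⟨0, hx.symm⟩ = 0 := by
      apply Fin.succAbove_right_injective (p := x)
      have := succAbove_eraseEnum (Equiv.refl _) x ⟨0, hx.symm⟩
      rw [Equiv.refl_apply] at this
      rw [this, Fin.succAbove_ne_zero_zero hx]
      rfl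
    rw [h2, coeff_const, h3]
  have h22 : eraseEnum (Equiv.refl (Fin (1 + 1 + 1))) 2 ⟨1, by decide⟩ = 1 := by
    apply Fin.succAbove_right_injective (p := 2)
    have := succAbove_eraseEnum (Equiv.refl (Fin (1 + 1 + 1))) 2 ⟨1, by decide⟩
    rw [Equiv.refl_apply] at this
    rw [this]
    rfl
  have hs1 : ∑ b : {y : Fin (1 + 1 + 1) // y ≠ 1}, φ (Finsupp.single 1 1) (RTree.corolla 0) *
      coeff φ (eraseEnum (Equiv.refl _) 1) b (erase f 1) =
      φ (Finsupp.single 1 1) (RTree.corolla 0) * (φ (Finsupp.single 0 1) (RTree.corolla 0) +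
        φ (Finsupp.single 1 1) (RTree.corolla 0)) := by
    rw [← Finset.mul_sum, Fintype.sum_congr _ _ fun b => herase 1 (by decide) b,
      Equiv.sum_comp (eraseEnum (Equiv.refl (Fin (1 + 1 + 1))) 1)
        fun i => φ (Finsupp.single i 1) (RTree.corolla 0), Fin.sum_univ_two]
  have hs2 : ∑ b : {y : Fin (1 + 1 + 1) // y ≠ 2},
      (if b.1 = 1 then φ (Finsupp.single 0 1) else 0) (RTree.corolla 0) *
      coeff φ (eraseEnum (Equiv.refl _) 2) b (erase f 2) =
      φ (Finsupp.single 0 1) (RTree.corolla 0) * φ (Finsupp.single 1 1) (RTree.corolla 0) := by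
    rw [Finset.sum_eq_single ⟨1, by decide⟩, herase 2 (by decide), h22, if_pos rfl]
    · intro b _ hb
      rw [if_neg fun h => hb (Subtype.ext h)]
      simp
    · simp
  rw [Fin.sum_univ_three]
  have e1 : (1 : Fin (1 + 1 + 1)) ≠ 0 := by decide
  have e2 : (2 : Fin (1 + 1 + 1)) ≠ 0 := by decide
  have e3 : (2 : Fin (1 + 1 + 1)) ≠ 1 := by decide
  simp only [hf0, coeff_of_not_isTree _ _ _ hnot, ite_self, mul_zero, Finset.sum_const_zero,
    hleaf 1 e1, hleaf 2 e2, or_true, if_true, if_neg e1.symm, if_neg e2.symm, if_neg e3, hs1, hs2,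
    zero_add]
  rw [h1]
  norm_num
  ring

theorem bracket_self (φ : ConvHom k (1 + 1)) :
    bracket (show 1 + 1 = 2 by rfl) φ φ =
      (2 : k) • conv (show (1 + 1) + 1 = 1 + 1 + 1 from rfl) φ φ := by
  refine convHom_ext fun v T => ?_
  rw [bracket, coeff_sub, coeff_smul, coeff_smul]
  ring

end LowArity

/-! ### Acyclicity and the homotopy automorphisms -/

section Main

variable {k : Type*} [Field k]

theorem eq_zero_of_diff_eq_zero {φ : ConvHom k (0 + 1)} (h : diff φ = 0) : φ = 0 := by
  obtain ⟨a, rfl⟩ := eq_smul_unitHom φ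
  rw [diff_smul, diff_unitHom] at h
  have h1 := congrArg (fun ψ : ConvHom k 2 => ψ (Finsupp.single 0 1) (RTree.corolla 0)) h
  have h2 : a = 0 := by simpa [alpha_apply_corolla] using h1
  rw [h2, zero_smul]

theorem rescale_comp_alpha (c : k) : PL.rescale k c 2 ∘ₗ alpha k = c • alpha k := by
  ext
  simp [PL.rescale]

variable [CharZero k]

theorem exists_diff_eq_of_arity_two {φ : ConvHom k (0 + 1 + 1)} (hφ : φ ∈ Def k (0 + 1))
    (hd : diff φ = 0) : ∃ ψ ∈ Def k 0, diff ψ = φ := by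
  have h0 : φ (Finsupp.single 0 1) (RTree.corolla 1) = 0 := by
    -- The root is not marked here, so `φ` agrees with `d h φ`. The latter is a multiple of `α`,
    -- which vanishes at such trees.
    have h1 := coeff_diff_homotopy hφ hd (Equiv.refl _) (v := 0) (RTree.corolla 1).isTree
      (Or.inl (by decide : (1 : Fin 2) ≠ 0))
    obtain ⟨a, ha⟩ := eq_smul_unitHom (homotopy φ)
    rw [ha, diff_smul, diff_unitHom, coeff_smul, coeff_refl, coeff_refl, alpha_apply_corolla] at h1
    rw [← h1]
    simp
  refine ⟨φ (Finsupp.single 0 1) (RTree.corolla 0) • unitHom k,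
    (Def k 0).smul_mem _ unitHom_mem_Def, ?_⟩
  rw [diff_smul, diff_unitHom]
  exact (eq_smul_alpha hφ h0).symm

theorem exists_diff_eq {p : ℕ} {φ : ConvHom k (p + 1 + 1)} (hφ : φ ∈ Def k (p + 1))
    (hd : diff φ = 0) : ∃ ψ ∈ Def k p, diff ψ = φ := by
  rcases Nat.eq_zero_or_pos p with rfl | hp
  · exact exists_diff_eq_of_arity_two hφ hd
  have hh := homotopy_mem_Def hφ
  -- The first use of the homotopy clears the coefficients at trees whose root is not marked, which
  -- is what its second use, on `φ'`, requires.
  set φ' := φ + (-1 : k) • diff (homotopy φ) with hφ'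
  have hmem : φ' ∈ Def k (p + 1) :=
    (Def k (p + 1)).add_mem hφ ((Def k (p + 1)).smul_mem _ (diff_mem_Def hh))
  have hd' : diff φ' = 0 := by rw [hφ', diff_add, diff_smul, hd, diff_diff hh, smul_zero, add_zero]
  have hroot : RootMarked φ' := by
    intro v T hv
    rw [hφ', coeff_add, coeff_smul, coeff_diff_homotopy hφ hd _ T.isTree (Or.inl hv)]
    ring
  refine ⟨homotopy φ + homotopy φ', (Def k p).add_mem hh (homotopy_mem_Def hmem),
    convHom_ext fun v T => ?_⟩
  rw [diff_add, coeff_add, coeff_diff_homotopy hmem hd' _ T.isTree (Or.inr ⟨hroot, hp⟩), hφ',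
    coeff_add, coeff_smul]
  ring

theorem isHomotopyAutomorphism_rescale (c : kˣ) :
    IsHomotopyAutomorphism (PL.rescale k (c : k) 2 ∘ₗ alpha k) := by
  rw [rescale_comp_alpha]
  have happ : ∀ (x : PLDual k 2) (v : Fin 2),
      ((c : k) • alpha k) x (RTree.corolla v) = c * ((-1) ^ (v : ℕ) * x v) := by
    intro x v
    rw [LinearMap.smul_apply, Finsupp.smul_apply, alpha_apply_corolla, smul_eq_mul]
  have hsign : ∀ v : Fin 2, ((-1 : k) ^ (v : ℕ)) * (-1) ^ (v : ℕ) = 1 := fun v => by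
    rw [← mul_pow]; simp
  refine ⟨(Def k 1).smul_mem _ alpha_mem_Def, ?_, ?_, ?_⟩
  · have h1 : conv (show (1 + 1) + 1 = 1 + 1 + 1 from rfl) (alpha k) (alpha k) = 0 := by
      -- The Maurer–Cartan equation for `α` is `d² = 0` applied to the unit, since `[α, α] = d α`.
      have h2 : diff (alpha k) = 0 := diff_unitHom (k := k) ▸ diff_diff unitHom_mem_Def
      have h3 : diff (alpha k) = (2 : k) • conv (show (1 + 1) + 1 = 1 + 1 + 1 from rfl)
        (alpha k) (alpha k) := bracket_self (alpha k)
      rw [h2] at h3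
      exact (smul_eq_zero.1 h3.symm).resolve_left two_ne_zero
    rw [bracket_self, conv_smul_left, conv_smul_right, h1]
    simp
  · intro x y hxy
    ext v
    have h := congrArg (fun z => z (RTree.corolla v)) hxy
    simp only [happ] at h
    exact mul_left_cancel₀ (pow_ne_zero _ (neg_ne_zero.2 one_ne_zero))
      (mul_left_cancel₀ c.ne_zero h)
  · intro y
    refine ⟨Finsupp.equivFunOnFinite.symm fun v =>
      (c : k)⁻¹ * ((-1) ^ (v : ℕ) * y (RTree.corolla v)), Finsupp.ext fun T => ?_⟩
    rw [RTree.eq_corolla T, happ]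
    generalize T.root = v
    have h1 := hsign v
    have h2 : (c : k) * (c : k)⁻¹ = 1 := mul_inv_cancel₀ c.ne_zero
    simp only [Finsupp.equivFunOnFinite_symm_apply_apply]
    linear_combination (c * (c : k)⁻¹ * y (RTree.corolla v)) * h1 + y (RTree.corolla v) * h2

theorem existsUnique_eq_rescale {φ : ConvHom k 2} (hφ : IsHomotopyAutomorphism φ) :
    ∃! c : kˣ, φ = PL.rescale k (c : k) 2 ∘ₗ alpha k := by
  have h1 : conv (show (1 + 1) + 1 = 1 + 1 + 1 from rfl) φ φ = 0 := by
    have h := hφ.maurerCartan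
    rwa [bracket_self, smul_smul, inv_mul_cancel₀ two_ne_zero, one_smul] at h
  have h2 : φ (Finsupp.single 0 1) (RTree.corolla 1) = 0 := by
    have h := conv_self_apply hφ.equivariant
    rw [h1] at h
    exact pow_eq_zero_iff two_ne_zero |>.1 h.symm
  have h3 := eq_smul_alpha hφ.equivariant h2
  set a := φ (Finsupp.single 0 1) (RTree.corolla 0) with ha
  have ha0 : a ≠ 0 := by
    intro h0
    rw [h0, zero_smul] at h3
    have h4 : (Finsupp.single 0 1 : PLDual k 2) = 0 :=
      hφ.bijective.injective (by rw [h3]; simp)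
    simp at h4
  refine ⟨Units.mk0 a ha0, ?_, fun c hc => ?_⟩
  · beta_reduce
    rw [rescale_comp_alpha]
    exact h3
  · apply Units.ext
    rw [Units.val_mk0, ha, hc, rescale_comp_alpha, LinearMap.smul_apply, Finsupp.smul_apply,
      alpha_apply_corolla]
    simp

end Main

end PreLieOperad

theorem mainTheorem1 (k : Type*) [Field k] [CharZero k] :
    -- the differential acts on the convolution algebra and squares to zero
    (∀ (p : ℕ), ∀ φ ∈ PreLieOperad.Def k p,
      PreLieOperad.diff φ ∈ PreLieOperad.Def k (p + 1) ∧
      PreLieOperad.diff (PreLieOperad.diff φ) = 0) ∧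
    -- the homology vanishes in degree zero and in every degree `-(p + 1)`
    (∀ φ ∈ PreLieOperad.Def k 0, PreLieOperad.diff φ = 0 → φ = 0) ∧
    (∀ (p : ℕ), ∀ φ ∈ PreLieOperad.Def k (p + 1), PreLieOperad.diff φ = 0 →
      ∃ ψ ∈ PreLieOperad.Def k p, PreLieOperad.diff ψ = φ) ∧
    -- the homotopy automorphisms are the rescalings, with a unique parameter
    (∀ c : kˣ, PreLieOperad.IsHomotopyAutomorphism
      (PreLieOperad.PL.rescale k (c : k) 2 ∘ₗ PreLieOperad.alpha k)) ∧
    (∀ φ : PreLieOperad.ConvHom k 2, PreLieOperad.IsHomotopyAutomorphism φ →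
      ∃! c : kˣ, φ = PreLieOperad.PL.rescale k (c : k) 2 ∘ₗ PreLieOperad.alpha k) := by
  exact ⟨fun p φ hφ => ⟨PreLieOperad.diff_mem_Def hφ, PreLieOperad.diff_diff hφ⟩,
    fun φ _ h => PreLieOperad.eq_zero_of_diff_eq_zero h,
    fun p φ hφ h => PreLieOperad.exists_diff_eq hφ h,
    PreLieOperad.isHomotopyAutomorphism_rescale,
    fun φ hφ => PreLieOperad.existsUnique_eq_rescale hφ⟩
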